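/- Consider a finite two-player zero-sum extensive-form game with perfect recall, in which every node belongs to one information set (infoset) of each player. Let $\sigma$ be a strategy profile (the blueprint), and for a node $h$ let $\pi^{\sigma}_{-1}(h)$ be the contribution of chance and of $P_2$ to the probability of reaching $h$. A subgame is a set of nodes closed under descendants and under the infosets of both players; let $\mathrm{Top}$ be the set of its earliest-reachable nodes, and assume $\sum_{h\in \mathrm{Top}}\pi_{-1}^{\sigma}(h)>0$. The augmented subgame $S'$ (as in Resolve subgame solving) starts with a chance node that selects $h\in \mathrm{Top}$ with probability $\pi^\sigma_{-1}(h)/\sum_{g\in \mathrm{Top}}\pi^\sigma_{-1}(g)$. Then $P_1$, knowing only her infoset $I_1$ containing $h$ (this decision infoset is denoted $I_{r,1}$), either takes action $a'_T$, which ends the game with the alternative payoff of $I_1$ to $P_1$, or takes action $a'_S$, which leads to $h$, after which play continues as in the original game. The alternative payoffs of $S'$ are arbitrary real numbers (in Resolve solving, $P_1$'s counterfactual best response values against the blueprint). For each infoset $I_1$ of $P_1$ containing a node of $\mathrm{Top}$, let $X_{I_1}$ be an integrable real random variable. The Distributional augmented subgame $S$ is the same as $S'$, except that at $I_{r,1}$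 the outcome $x$ of $X_{I_1}$ is drawn, $P_1$ (but not $P_2$) observes and remembers it, and the alternative payoff equals $x$. Strategies of $P_1$ in $S$ may depend measurably on $x$. Run CFR (simultaneous updates, regret matching, initial regrets zero) on $S'$, except that on each iteration $t$, at each $I_{r,1}$, the action $a'_S$ is taken with probability $P\big(X_{I_1}\le v^t(I_{r,1},a'_S)\big)$ (and $a'_T$ otherwise), where $v^t(I_{r,1},a'_S)$ is the expected value to $P_1$ of $a'_S$ under the profile of iteration $t$. Let $\bar\sigma_2^T$ be the resulting $P_2$ strategy after $T$ iterations, i.e. the CFR average strategy, weighted by $P_2$'s own reach probabilities. Then $\bar\sigma_2^T$ converges to the set of $P_2$ Nash equilibrium strategies of $S$, in the following sense: 1. for every $\epsilon>0$, for all sufficiently large $T$ there is a $P_1$ strategy $\sigma_1$ in $S$ such that $(\sigma_1,\bar\sigma_2^T)$ is an $\epsilon$-Nash equilibrium of $S$; 2. every cluster point $\sigma_2$ of the sequence $(\bar\sigma_2^T)_T$ is a $P_2$ Nash equilibrium strategy of $S$: there is a $P_1$ strategy $\sigma_1$ in $S$ such that $(\sigma_1,\sigma_2)$ is a Nash equilibrium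 of $S$. -/

import Mathlib

open Filter Topology MeasureTheory

universe u v w

noncomputable section

open scoped Classical

/-- The two (non-chance) players. -/
inductive Player : Type
  | one
  | two

/-- The actions available after the node `h`, given the finite set `H` of nodes. -/
def actsIn {A : Type u} (H : Finset (List A)) (h : List A) : Finset A :=
  H.preimage (fun a => h ++ [a]) (fun a _ b _ hab => by simpa using hab)

theorem mem_actsIn {A : Type u} {H : Finset (List A)} {h : List A} {a : A} :
    a ∈ actsIn H h ↔ h ++ [a] ∈ H := by
  exact Finset.mem_preimage

/-- A finite two-player zero-sum extensive-form game.  Nodes are finite sequences of actions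
(`h · a` is `h ++ [a]`).  Every node has an information set for *each* player, named by
`info i h`.  A node without available actions is terminal. -/
structure Game (A : Type u) (Info : Player → Type v) where
  /-- the nodes of the game -/
  hist : Finset (List A)
  nil_mem : [] ∈ hist
  prefix_mem : ∀ h a, h ++ [a] ∈ hist → h ∈ hist
  /-- who acts at a (nonterminal) node: a player, or chance (`none`) -/
  turn : List A → Option Player
  /-- the fixed action probabilities of chance -/
  chance : List A → A → ℝ
  chance_nonneg : ∀ h ∈ hist, turn h = none → ∀ a ∈ actsIn hist h, 0 ≤ chance h a
  chance_sum : ∀ h ∈ hist, turn h = none → (actsIn hist h).Nonempty →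
    ∑ a ∈ actsIn hist h, chance h a = 1
  /-- the name of the information set of player `i` that contains `h` -/
  info : (i : Player) → List A → Info i
  /-- at all nodes of an information set of the player to act, that player acts and has the
  same actions -/
  info_acts : ∀ i, ∀ h ∈ hist, ∀ g ∈ hist, info i h = info i g → turn h = some i →
    (actsIn hist h).Nonempty → turn g = some i ∧ actsIn hist g = actsIn hist h
  /-- the payoff of player one at terminal nodes; player two receives its negative -/
  payoff : List A → ℝ

/-- A behavioral strategy: to each information set, weights on the actions. -/
abbrev Strategy (A : Type u) (I : Type v) : Type (max u v) := I → A → ℝ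

/-- A strategy for each player. -/
abbrev Profile (A : Type u) (Info : Player → Type v) : Type (max u v) :=
  (i : Player) → Strategy A (Info i)

/-- The profile made of a strategy of player one and a strategy of player two. -/
def mkProfile {A : Type u} {Info : Player → Type v} (s₁ : Strategy A (Info .one))
    (s₂ : Strategy A (Info .two)) : Profile A Info
  | .one => s₁
  | .two => s₂

/-- `pathProb f h w` is the product of the step weights `f` along the path from `h` to
`h ++ w`. -/
def pathProb {A : Type u} (f : List A → A → ℝ) : List A → List A → ℝ
  | _, [] => 1
  | h, a :: w => f h a * pathProb f (h ++ [a]) w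

theorem pathProb_nonneg {A : Type u} (f : List A → A → ℝ) (H : Finset (List A))
    (hH : ∀ h a, h ++ [a] ∈ H → h ∈ H)
    (hf : ∀ h ∈ H, ∀ a ∈ actsIn H h, 0 ≤ f h a) (w : List A) :
    ∀ h, h ++ w ∈ H → 0 ≤ pathProb f h w := by
  have pre : ∀ (w h : List A), h ++ w ∈ H → h ∈ H := by
    intro w
    induction w using List.reverseRecOn with
    | nil => intro h hh; simpa using hh
    | append_singleton w a ih =>
      intro h hh
      exact ih h (hH _ a (by simpa using hh))
  induction w with
  | nil => intro h _; simp [pathProb]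
  | cons a w ih =>
    intro h hh
    have h1 : (h ++ [a]) ++ w ∈ H := by simpa using hh
    exact mul_nonneg (hf h (pre _ _ hh) a (mem_actsIn.2 (pre _ _ h1))) (ih _ h1)

namespace Game

variable {A : Type u} {Info : Player → Type v}

/-- The actions available at a node. -/
def acts (G : Game A Info) (h : List A) : Finset A := actsIn G.hist h

/-- The terminal nodes. -/
def terminals (G : Game A Info) : Finset (List A) := G.hist.filter (fun z => G.acts z = ∅)

/-- The nodes in the information set of player `i` with name `J`. -/
def infoset (G : Game A Info) (i : Player) (J : Info i) : Finset (List A) :=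
  G.hist.filter (fun h => G.info i h = J)

/-- The actions available in an information set. -/
def infosetActs (G : Game A Info) (i : Player) (J : Info i) : Finset A :=
  (G.infoset i J).biUnion G.acts

/-- The payoff of player `i` at a terminal node. -/
def util (G : Game A Info) (i : Player) (z : List A) : ℝ :=
  match i with
  | .one => G.payoff z
  | .two => - G.payoff z

/-- `s` is a strategy of player `i`: a probability vector over the available actions at each
information set in which `i` acts. -/
def IsStrategy (G : Game A Info) (i : Player) (s : Strategy A (Info i)) : Prop :=
  ∀ h ∈ G.hist, G.turn h = some i → (G.acts h).Nonempty →
    (∀ a, 0 ≤ s (G.info i h) a) ∧ (∀ a, a ∉ G.acts h → s (G.info i h) a = 0) ∧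
      ∑ a ∈ G.acts h, s (G.info i h) a = 1

/-- The probability of action `a` at the node `h`. -/
def stepProb (G : Game A Info) (σ : Profile A Info) (h : List A) (a : A) : ℝ :=
  match G.turn h with
  | none => G.chance h a
  | some i => σ i (G.info i h) a

/-- The probability of reaching `z` given that `h` has been reached. -/
def reachFrom (G : Game A Info) (σ : Profile A Info) (h z : List A) : ℝ :=
  if h <+: z then pathProb (G.stepProb σ) h (z.drop h.length) else 0

/-- The contribution of player `i` to the probability of reaching `h`. -/
def reachOwn (G : Game A Info) (σ : Profile A Info) (i : Player) (h : List A) : ℝ :=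
  pathProb (fun g a => if G.turn g = some i then G.stepProb σ g a else 1) [] h

/-- The contribution of chance and of the player other than `i` to the probability of
reaching `h`. -/
def reachOther (G : Game A Info) (σ : Profile A Info) (i : Player) (h : List A) : ℝ :=
  pathProb (fun g a => if G.turn g = some i then 1 else G.stepProb σ g a) [] h

/-- The expected value of the node `h` for player `i`. -/
def value (G : Game A Info) (σ : Profile A Info) (i : Player) (h : List A) : ℝ :=
  ∑ z ∈ G.terminals, G.reachFrom σ h z * G.util i z

/-- The expected value, for player `i`, of the action `a` in an information set. -/
def infosetActValue (G : Game A Info) (σ : Profile A Info) (i : Player) (J : Info i) (a : A) : ℝ :=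
  (∑ h ∈ G.infoset i J, G.reachOther σ i h * G.value σ i (h ++ [a])) /
    ∑ h ∈ G.infoset i J, G.reachOther σ i h

/-- The contribution of player `i` to reaching the information set `J`.  Under perfect recall
all nodes of `J` have the same such contribution, so the mean is that common value. -/
def infosetReach (G : Game A Info) (σ : Profile A Info) (i : Player) (J : Info i) : ℝ :=
  (∑ h ∈ G.infoset i J, G.reachOwn σ i h) / (G.infoset i J).card

/-- Perfect recall: the current information set of a player determines the information sets of
that player passed before and the actions taken by that player there. -/
def PerfectRecall (G : Game A Info) : Prop :=
  ∀ i, ∀ h ∈ G.hist, ∀ h' ∈ G.hist, G.info i h = G.info i h' →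
    ∀ g, g <+: h → ∃ g', g' <+: h' ∧ G.info i g' = G.info i g ∧
      ∀ a, G.turn g = some i → g ++ [a] <+: h → g' ++ [a] <+: h'

/-! ### Counterfactual regret minimization -/

/-- The instantaneous counterfactual regret of player `i` for not playing `a` in `J`. -/
def instRegret (G : Game A Info) (σ : Profile A Info) : Profile A Info := fun i J a =>
  ∑ h ∈ G.infoset i J, G.reachOther σ i h * (G.value σ i (h ++ [a]) - G.value σ i h)

/-- The regret-matching profile for the cumulative regrets `R`: probabilities proportional to
the positive parts of the regrets, uniform if no regret is positive. -/
def regretMatching (G : Game A Info) (R : Profile A Info) : Profile A Info := fun i J a =>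
  if a ∈ G.infosetActs i J then
    if 0 < ∑ b ∈ G.infosetActs i J, max (R i J b) 0 then
      max (R i J a) 0 / ∑ b ∈ G.infosetActs i J, max (R i J b) 0
    else 1 / (G.infosetActs i J).card
  else 0

/-- The cumulative regrets after `t` iterations of counterfactual regret minimization in which,
on each iteration, the regret-matching profile is modified by `patch` before it is played
(`patch = id` is the unmodified algorithm). -/
def cfrRegret (G : Game A Info) (patch : Profile A Info → Profile A Info) : ℕ → Profile A Info
  | 0 => fun _ _ _ => 0
  | t + 1 => fun i J a => cfrRegret G patch t i J a +
      G.instRegret (patch (G.regretMatching (cfrRegret G patch t))) i J a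

/-- The profile played on the iteration that follows the first `t` iterations. -/
def cfrProfile (G : Game A Info) (patch : Profile A Info → Profile A Info) (t : ℕ) :
    Profile A Info :=
  patch (G.regretMatching (G.cfrRegret patch t))

/-- The output of `T` iterations: the average strategy of player `i`, where each iteration is
weighted by the contribution of `i` to reaching the information set (uniform where all weights
vanish). -/
def cfrAverage (G : Game A Info) (patch : Profile A Info → Profile A Info) (T : ℕ) (i : Player) :
    Strategy A (Info i) := fun J a =>
  if (∑ t ∈ Finset.range T, G.infosetReach (G.cfrProfile patch t) i J) = 0 then
    if a ∈ G.infosetActs i J then 1 / (G.infosetActs i J).card else 0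
  else
    (∑ t ∈ Finset.range T, G.infosetReach (G.cfrProfile patch t) i J * G.cfrProfile patch t i J a) /
      ∑ t ∈ Finset.range T, G.infosetReach (G.cfrProfile patch t) i J

/-! ### Subgames -/

/-- An imperfect-information subgame: a set of nodes closed under descendants and under the
information sets of both players. -/
structure Subgame (G : Game A Info) where
  nodes : Finset (List A)
  subset : nodes ⊆ G.hist
  desc_mem : ∀ h ∈ nodes, ∀ g ∈ G.hist, h <+: g → g ∈ nodes
  info_mem : ∀ i, ∀ h ∈ nodes, ∀ g ∈ G.hist, G.info i g = G.info i h → g ∈ nodes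

/-- The earliest-reachable nodes of a subgame. -/
def Subgame.top {G : Game A Info} (S : G.Subgame) : Finset (List A) :=
  S.nodes.filter (fun h => ∀ g, g <+: h → g ∈ S.nodes → g = h)

end Game

/-- Actions of an augmented subgame: the initial chance action that selects an earliest-reachable
node of the subgame, the two actions of player one at the root (enter the subgame, or take the
alternative payoff), and the actions of the original game. -/
inductive AugAct (A : Type u) : Type u
  | start (h : List A)
  | enter
  | alt
  | act (a : A)

/-- Names of information sets in an augmented subgame: `pre` before (or without) any
information, `root J` at the root decision for an earliest-reachable information set `J`, `out J`
after the alternative payoff has been taken there, and `sub J` for the information set `J` of the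
subgame. -/
inductive AugInfo (I : Type v) : Type v
  | pre
  | root (J : I)
  | out (J : I)
  | sub (J : I)

/-- The underlying action of the original game, if there is one. -/
def AugAct.orig? {A : Type u} : AugAct A → Option A
  | .act a => some a
  | _ => none

theorem AugAct.filterMap_act {A : Type u} (w : List A) :
    (w.map AugAct.act).filterMap AugAct.orig? = w := by
  induction w with
  | nil => rfl
  | cons a w ih => simp [AugAct.orig?, ih]

namespace Game

variable {A : Type u} {Info : Player → Type v} {G : Game A Info}

/-- The nodes of the augmented subgame: the initial chance node, a node of player one for each
earliest-reachable `h`, the terminal node after the alternative payoff, and the nodes of the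
subgame. -/
def augHist (S : G.Subgame) : Finset (List (AugAct A)) :=
  {[]} ∪ S.top.image (fun h => [AugAct.start h]) ∪
    S.top.image (fun h => [AugAct.start h, AugAct.alt]) ∪
    S.top.biUnion (fun h => (G.hist.filter (fun g => h <+: g)).image
      (fun g => AugAct.start h :: AugAct.enter :: (g.drop h.length).map AugAct.act))

theorem mem_augHist {S : G.Subgame} {x : List (AugAct A)} :
    x ∈ augHist S ↔ x = [] ∨ (∃ h ∈ S.top, x = [AugAct.start h]) ∨
      (∃ h ∈ S.top, x = [AugAct.start h, AugAct.alt]) ∨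
      (∃ h ∈ S.top, ∃ w, h ++ w ∈ G.hist ∧
        x = AugAct.start h :: AugAct.enter :: w.map AugAct.act) := by
  simp only [augHist, Finset.mem_union, Finset.mem_singleton, Finset.mem_image, Finset.mem_biUnion,
    Finset.mem_filter, or_assoc]
  refine or_congr Iff.rfl (or_congr ?_ (or_congr ?_ ?_))
  · exact exists_congr fun h => and_congr Iff.rfl eq_comm
  · exact exists_congr fun h => and_congr Iff.rfl eq_comm
  · refine exists_congr fun h => and_congr Iff.rfl ?_
    constructor
    · rintro ⟨g, ⟨hg, w, rfl⟩, rfl⟩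
      exact ⟨w, hg, by simp⟩
    · rintro ⟨w, hw, rfl⟩
      exact ⟨h ++ w, ⟨hw, w, rfl⟩, by simp⟩

/-- The player to act in the augmented subgame. -/
def augTurn (G : Game A Info) : List (AugAct A) → Option Player
  | [] => none
  | [.start _] => some .one
  | .start h :: .enter :: w => G.turn (h ++ w.filterMap AugAct.orig?)
  | _ => none

/-- The chance probabilities of the augmented subgame.  The initial chance node selects `h` in
proportion to the contribution of chance and of player two (under the blueprint `σ`) to the
probability of reaching `h`. -/
def augChance (S : G.Subgame) (σ : Profile A Info) : List (AugAct A) → AugAct A → ℝ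
  | [], .start h => G.reachOther σ .one h / ∑ g ∈ S.top, G.reachOther σ .one g
  | .start h :: .enter :: w, .act a => G.chance (h ++ w.filterMap AugAct.orig?) a
  | _, _ => 0

/-- The information sets of the augmented subgame.  At the root decision, player one knows
exactly the own information set of the selected node; player two knows nothing yet. -/
def augInfo (G : Game A Info) : (i : Player) → List (AugAct A) → AugInfo (Info i)
  | .one, [.start h] => .root (G.info .one h)
  | .one, [.start h, .alt] => .out (G.info .one h)
  | i, .start h :: .enter :: w => .sub (G.info i (h ++ w.filterMap AugAct.orig?))
  | _, _ => .pre

/-- The payoffs of player one in the augmented subgame with alternative payoffs `altPay`. -/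
def augPayoff (G : Game A Info) (altPay : Info .one → ℝ) : List (AugAct A) → ℝ
  | [.start h, .alt] => altPay (G.info .one h)
  | .start h :: .enter :: w => G.payoff (h ++ w.filterMap AugAct.orig?)
  | _ => 0

theorem reachOther_one_nonneg (S : G.Subgame) (σ : Profile A Info)
    (hσ : G.IsStrategy .two (σ .two)) {h : List A} (hh : h ∈ S.top) :
    0 ≤ G.reachOther σ .one h := by
  refine pathProb_nonneg _ G.hist G.prefix_mem ?_ h [] ?_
  · intro g hg a ha
    by_cases h1 : G.turn g = some .one
    · simp [h1]
    · simp only [h1, if_false, stepProb]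
      rcases h2 : G.turn g with _ | i
      · exact G.chance_nonneg g hg h2 a ha
      · cases i with
        | one => exact absurd h2 h1
        | two => exact (hσ g hg h2 ⟨a, ha⟩).1 a
  · simpa using S.subset (Finset.mem_filter.1 hh).1

theorem actsIn_augHist_nil (S : G.Subgame) :
    actsIn (augHist S) [] = S.top.image AugAct.start := by
  ext a
  simp only [mem_actsIn, mem_augHist, List.nil_append, Finset.mem_image]
  constructor
  · rintro (h | ⟨h, hh, e⟩ | ⟨h, hh, e⟩ | ⟨h, hh, w, hw, e⟩)
    · simp at h
    · exact ⟨h, hh, by simpa using e.symm⟩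
    · simp at e
    · simp at e
  · rintro ⟨h, hh, rfl⟩
    exact Or.inr (Or.inl ⟨h, hh, rfl⟩)

theorem actsIn_augHist_start (S : G.Subgame) {h : List A} (hh : h ∈ S.top) :
    actsIn (augHist S) [AugAct.start h] = {AugAct.enter, AugAct.alt} := by
  ext a
  simp only [mem_actsIn, mem_augHist, Finset.mem_insert, Finset.mem_singleton]
  constructor
  · rintro (e | ⟨g, hg, e⟩ | ⟨g, hg, e⟩ | ⟨g, hg, w, hw, e⟩)
    · simp at e
    · simp at e
    · simp at e
      exact Or.inr e.2
    · simp at e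
      exact Or.inl e.2.1
  · rintro (rfl | rfl)
    · refine Or.inr (Or.inr (Or.inr ⟨h, hh, [], ?_, rfl⟩))
      simpa using S.subset (Finset.mem_filter.1 hh).1
    · exact Or.inr (Or.inr (Or.inl ⟨h, hh, rfl⟩))

theorem actsIn_augHist_alt (S : G.Subgame) (h : List A) :
    actsIn (augHist S) [AugAct.start h, AugAct.alt] = ∅ := by
  ext a
  simp only [mem_actsIn, mem_augHist, Finset.notMem_empty, iff_false]
  rintro (e | ⟨g, hg, e⟩ | ⟨g, hg, e⟩ | ⟨g, hg, w, hw, e⟩) <;> simp at e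

theorem actsIn_augHist_enter (S : G.Subgame) {h : List A} (hh : h ∈ S.top) (w : List A) :
    actsIn (augHist S) (AugAct.start h :: AugAct.enter :: w.map AugAct.act) =
      (actsIn G.hist (h ++ w)).image AugAct.act := by
  ext a
  simp only [mem_actsIn, mem_augHist, Finset.mem_image]
  constructor
  · rintro (e | ⟨g, hg, e⟩ | ⟨g, hg, e⟩ | ⟨g, hg, w', hw, e⟩)
    · simp at e
    · simp at e
    · simp at e
    · simp only [List.cons_append, List.cons.injEq, AugAct.start.injEq, true_and] at e
      obtain ⟨rfl, e⟩ := e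
      have e2 := congrArg (List.filterMap AugAct.orig?) e
      rw [List.filterMap_append, AugAct.filterMap_act, AugAct.filterMap_act] at e2
      have e3 := congrArg List.length e
      subst e2
      cases a with
      | act b => exact ⟨b, by simpa [AugAct.orig?] using hw, rfl⟩
      | start _ => simp [AugAct.orig?, List.filterMap] at e3
      | enter => simp [AugAct.orig?, List.filterMap] at e3
      | alt => simp [AugAct.orig?, List.filterMap] at e3
  · rintro ⟨b, hb, rfl⟩
    exact Or.inr (Or.inr (Or.inr ⟨h, hh, w ++ [b], by simpa using hb, by simp⟩))

/-- The augmented subgame of a subgame `S` for the blueprint `σ` and alternative payoffs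
`altPay`.  A chance node selects an earliest-reachable node `h` of `S`, in proportion to the
contribution of chance and player two to reaching `h` under the blueprint; then player one, who
knows only the own information set of `h`, either enters the subgame at `h` or ends the game with
the alternative payoff of that information set. -/
def aug (S : G.Subgame) (σ : Profile A Info) (hσ : G.IsStrategy .two (σ .two))
    (hpos : 0 < ∑ h ∈ S.top, G.reachOther σ .one h) (altPay : Info .one → ℝ) :
    Game (AugAct A) (fun i => AugInfo (Info i)) where
  hist := augHist S
  nil_mem := mem_augHist.2 (Or.inl rfl)
  prefix_mem := by
    intro x a hx
    rcases mem_augHist.1 hx with e | ⟨h, hh, e⟩ | ⟨h, hh, e⟩ | ⟨h, hh, w, hw, e⟩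
    · simp at e
    · have : x = [] := by simpa using congrArg List.dropLast e
      exact mem_augHist.2 (Or.inl this)
    · have : x = [AugAct.start h] := by simpa using congrArg List.dropLast e
      exact mem_augHist.2 (Or.inr (Or.inl ⟨h, hh, this⟩))
    · rcases List.eq_nil_or_concat w with rfl | ⟨w', b, rfl⟩
      · have : x = [AugAct.start h] := by simpa using congrArg List.dropLast e
        exact mem_augHist.2 (Or.inr (Or.inl ⟨h, hh, this⟩))
      · have e1 : x ++ [a] =
            (AugAct.start h :: AugAct.enter :: w'.map AugAct.act) ++ [AugAct.act b] := by
          simpa using e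
        have : x = AugAct.start h :: AugAct.enter :: w'.map AugAct.act :=
          (List.append_inj' e1 rfl).1
        refine mem_augHist.2 (Or.inr (Or.inr (Or.inr ⟨h, hh, w', ?_, this⟩)))
        exact G.prefix_mem _ b (by simpa using hw)
  turn := G.augTurn
  chance := augChance S σ
  chance_nonneg := by
    intro x hx ht a ha
    rcases mem_augHist.1 hx with rfl | ⟨h, hh, rfl⟩ | ⟨h, hh, rfl⟩ | ⟨h, hh, w, hw, rfl⟩
    · rw [actsIn_augHist_nil] at ha
      obtain ⟨h, hh, rfl⟩ := Finset.mem_image.1 ha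
      exact div_nonneg (reachOther_one_nonneg S σ hσ hh) hpos.le
    · simp [augTurn] at ht
    · simp [actsIn_augHist_alt] at ha
    · rw [actsIn_augHist_enter S hh] at ha
      obtain ⟨b, hb, rfl⟩ := Finset.mem_image.1 ha
      simp only [augTurn, AugAct.filterMap_act] at ht
      simp only [augChance, AugAct.filterMap_act]
      exact G.chance_nonneg _ hw ht b hb
  chance_sum := by
    intro x hx ht hne
    rcases mem_augHist.1 hx with rfl | ⟨h, hh, rfl⟩ | ⟨h, hh, rfl⟩ | ⟨h, hh, w, hw, rfl⟩
    · rw [actsIn_augHist_nil, Finset.sum_image (by intro a _ b _ e; simpa using e)]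
      simp only [augChance]
      rw [← Finset.sum_div, div_self hpos.ne']
    · simp [augTurn] at ht
    · simp [actsIn_augHist_alt] at hne
    · rw [actsIn_augHist_enter S hh] at hne ⊢
      rw [Finset.sum_image (by intro a _ b _ e; simpa using e)]
      simp only [augTurn, AugAct.filterMap_act] at ht
      simp only [augChance, AugAct.filterMap_act]
      exact G.chance_sum _ hw ht (by simpa using hne)
  info := G.augInfo
  info_acts := by
    intro i x hx y hy hxy ht hne
    rcases mem_augHist.1 hx with rfl | ⟨h, hh, rfl⟩ | ⟨h, hh, rfl⟩ | ⟨h, hh, w, hw, rfl⟩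
    · simp [augTurn] at ht
    · obtain rfl : Player.one = i := by simpa [augTurn] using ht
      rcases mem_augHist.1 hy with rfl | ⟨g, hg, rfl⟩ | ⟨g, hg, rfl⟩ | ⟨g, hg, w', hw', rfl⟩
      · simp [augInfo] at hxy
      · exact ⟨rfl, by rw [actsIn_augHist_start S hh, actsIn_augHist_start S hg]⟩
      · simp [augInfo] at hxy
      · simp [augInfo] at hxy
    · simp [actsIn_augHist_alt] at hne
    · rw [actsIn_augHist_enter S hh] at hne ⊢
      simp only [augTurn, AugAct.filterMap_act] at ht
      rcases mem_augHist.1 hy with rfl | ⟨g, hg, rfl⟩ | ⟨g, hg, rfl⟩ | ⟨g, hg, w', hw', rfl⟩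
      · cases i <;> simp [augInfo] at hxy
      · cases i <;> simp [augInfo] at hxy
      · cases i <;> simp [augInfo] at hxy
      · have hi : G.info i (h ++ w) = G.info i (g ++ w') := by
          cases i <;> simpa only [augInfo, AugAct.filterMap_act, AugInfo.sub.injEq] using hxy
        obtain ⟨h1, h2⟩ := G.info_acts i _ hw _ hw' hi ht (by simpa using hne)
        rw [actsIn_augHist_enter S hg, h2]
        simp only [augTurn, AugAct.filterMap_act]
        exact ⟨h1, trivial⟩
  payoff := G.augPayoff altPay

/-! ### Random alternative payoffs -/

section Distributional

variable {Ω : Type w} [MeasurableSpace Ω]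

/-- The modification of CFR in the augmented subgame: at each root information set of player
one, belonging to the information set `J` of the subgame, the action that enters the subgame is
taken with the probability that `X J` is at most the current expected value of that action. -/
def rootPatch (G' : Game (AugAct A) (fun i => AugInfo (Info i))) (P : Measure Ω)
    (X : Info .one → Ω → ℝ) (τ : Profile (AugAct A) (fun i => AugInfo (Info i))) :
    Profile (AugAct A) (fun i => AugInfo (Info i))
  | .one, .root J, .enter => P.real {ω | X J ω ≤ G'.infosetActValue τ .one (.root J) .enter}
  | .one, .root J, .alt => 1 - P.real {ω | X J ω ≤ G'.infosetActValue τ .one (.root J) .enter}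
  | .one, .root _, _ => 0
  | i, K, a => τ i K a

variable (S : G.Subgame) (σ : Profile A Info) (hσ : G.IsStrategy .two (σ .two))
  (hpos : 0 < ∑ h ∈ S.top, G.reachOther σ .one h)

/-- A strategy of player one in the distributional augmented subgame.  There player one observes
at the root the outcome `x` of the random alternative payoff and remembers it, so that the
information sets of player one are those of the augmented subgame together with `x`. -/
def IsDistStrategy (s₁ : ℝ → Strategy (AugAct A) (AugInfo (Info .one))) : Prop :=
  (∀ x, (aug S σ hσ hpos (fun _ => 0)).IsStrategy .one (s₁ x)) ∧
    ∀ K a, Measurable (fun x => s₁ x K a)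

/-- A strategy of player two in the distributional augmented subgame.  Player two does not observe
the outcome of the random alternative payoff. -/
def IsDistStrategyTwo (s₂ : Strategy (AugAct A) (AugInfo (Info .two))) : Prop :=
  (aug S σ hσ hpos (fun _ => 0)).IsStrategy .two s₂

/-- The expected payoff of player one in the distributional augmented subgame: chance selects an
earliest-reachable node `h` as in the augmented subgame, then the outcome of `X J` is drawn, where
`J` is the information set of player one that contains `h`; this outcome is the alternative payoff
and is observed by player one only. -/
def distPayoff (P : Measure Ω) (X : Info .one → Ω → ℝ)
    (s₁ : ℝ → Strategy (AugAct A) (AugInfo (Info .one)))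
    (s₂ : Strategy (AugAct A) (AugInfo (Info .two))) : ℝ :=
  ∑ h ∈ S.top, augChance S σ [] (.start h) *
    ∫ ω, (aug S σ hσ hpos (fun _ => X (G.info .one h) ω)).value
      (mkProfile (Info := fun i => AugInfo (Info i)) (s₁ (X (G.info .one h) ω)) s₂)
      .one [AugAct.start h] ∂P

/-- `(s₁, s₂)` is an `ε`-Nash equilibrium of the distributional augmented subgame. -/
def IsDistEpsNash (P : Measure Ω) (X : Info .one → Ω → ℝ) (ε : ℝ)
    (s₁ : ℝ → Strategy (AugAct A) (AugInfo (Info .one)))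
    (s₂ : Strategy (AugAct A) (AugInfo (Info .two))) : Prop :=
  IsDistStrategy S σ hσ hpos s₁ ∧ IsDistStrategyTwo S σ hσ hpos s₂ ∧
    (∀ s₁', IsDistStrategy S σ hσ hpos s₁' →
      distPayoff S σ hσ hpos P X s₁' s₂ ≤ distPayoff S σ hσ hpos P X s₁ s₂ + ε) ∧
    (∀ s₂', IsDistStrategyTwo S σ hσ hpos s₂' →
      - distPayoff S σ hσ hpos P X s₁ s₂' ≤ - distPayoff S σ hσ hpos P X s₁ s₂ + ε)

/-- `s₂` is a Nash equilibrium strategy of player two in the distributional augmented subgame: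
it is part of a Nash equilibrium. -/
def IsDistNashStrategyTwo (P : Measure Ω) (X : Info .one → Ω → ℝ)
    (s₂ : Strategy (AugAct A) (AugInfo (Info .two))) : Prop :=
  ∃ s₁, IsDistEpsNash S σ hσ hpos P X 0 s₁ s₂

/-- The strategy of player two after `T` iterations of CFR in the augmented subgame with
alternative payoffs `altPay`, modified at the root information sets of player one. -/
def gadgetCFR (altPay : Info .one → ℝ) (P : Measure Ω) (X : Info .one → Ω → ℝ) (T : ℕ) :
    Strategy (AugAct A) (AugInfo (Info .two)) :=
  (aug S σ hσ hpos altPay).cfrAverage (rootPatch (aug S σ hσ hpos altPay) P X) T .two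

end Distributional

end Game

end

/-!
Write `c h` for the probability with which chance selects `h`, and `v h` for the value of entering
the subgame at `h`. The argument has three parts.

*Regret.* By the performance difference identity (`Game.value_sub_eq`) the gain of a deviation is a
sum of one-step gains along the play. Perfect recall makes a player's own contribution to reaching a
node a function of the information set (`Game.PerfectRecall.reachOwn_eq`), so the one-step gains
group into instantaneous counterfactual regrets (`Game.sum_reach_mul_value_sub`). This holds for
play that starts from any family of nodes closed under the information sets of the deviating player
(`Game.IsCut`). Regret matching keeps the positive part of every cumulative regret of order `√T`
(`Game.sum_max_cfrRegret_le`), so that the total gain below such a cut is of order `√T`, whatever is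
done at information sets that are not below it (`Game.exists_cfr_regret_le`). In the augmented
subgame this applies to player two below all the nodes at which the subgame is entered, and to
player one below those that belong to one root information set; the modified root decisions lie
above these cuts.

*Approximate saddle point.* If `x` is observed at the root information set that belongs to `J`,
entering exactly when `x` is at most the value of entering on iteration `t` is a best response to
that value (`Game.sum_root_le_gadgetOutcome`), and averaged over `x` it is the modified root
decision of the algorithm. So player one has no regret at the root, and little regret below it,
against the strategies that player two uses. The average strategy of player one,
`Game.gadgetDistOne`, enters with the frequency of the iterations whose value of entering is at
least `x`, and from then on plays the CFR average, forgetting `x`. Averages are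
realization-equivalent to uniform mixtures (`Game.reachOwn_averageStrategy`). Both bounds together
give `u s₁ (average of two) ≤ u (average of one) s₂ + C / √T` for all `s₁` and `s₂`
(`Game.exists_gap_le`), which is the first claim.

*Limits.* Let `s₂` be a limit of the averages of player two along an ultrafilter. The payoff is
continuous in the strategy of player two (`Game.tendsto_distPayoff`). The averages of player one
depend on `x` at the root only, hence enter the payoff through finitely many bounded numbers: the
probabilities of the CFR average, and the mean alternative payoff foregone at each root information
set. These converge along the ultrafilter, and by a Neyman–Pearson argument
(`exists_threshold_rule`) some measurable root decision has the limiting probability of entering and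
foregoes no more. The resulting strategy and `s₂` are an exact saddle point.
-/

noncomputable section

open scoped Classical

/-! ### Products along paths -/

section PathProb

variable {A : Type u}

theorem pathProb_append (f : List A → A → ℝ) (w w' : List A) : ∀ h,
    pathProb f h (w ++ w') = pathProb f h w * pathProb f (h ++ w) w' := by
  induction w with
  | nil => intro h; simp [pathProb]
  | cons a w ih => intro h; simp [pathProb, ih, mul_assoc]

theorem pathProb_append_singleton (f : List A → A → ℝ) (h w : List A) (a : A) :
    pathProb f h (w ++ [a]) = pathProb f h w * f (h ++ w) a := by
  simp [pathProb_append, pathProb]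

theorem pathProb_mul (f f' : List A → A → ℝ) (w : List A) : ∀ h,
    pathProb (fun g a => f g a * f' g a) h w = pathProb f h w * pathProb f' h w := by
  induction w with
  | nil => intro h; simp [pathProb]
  | cons a w ih => intro h; simp only [pathProb, ih]; ring

theorem pathProb_congr {f f' : List A → A → ℝ} (w : List A) : ∀ h,
    (∀ g a, h <+: g → g ++ [a] <+: h ++ w → f g a = f' g a) →
      pathProb f h w = pathProb f' h w := by
  induction w with
  | nil => intro h _; rfl
  | cons a w ih =>
    intro h H
    simp only [pathProb]
    rw [H h a (List.prefix_refl h) (by simp), ih (h ++ [a])]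
    intro g b h1 h2
    exact H g b ((List.prefix_append h [a]).trans h1) (by simpa using h2)

theorem pathProb_mem_Icc (f : List A → A → ℝ) (w : List A) : ∀ h,
    (∀ g a, h <+: g → g ++ [a] <+: h ++ w → f g a ∈ Set.Icc (0 : ℝ) 1) →
      pathProb f h w ∈ Set.Icc (0 : ℝ) 1 := by
  induction w with
  | nil => intro h _; simp [pathProb]
  | cons a w ih =>
    intro h H
    have h1 := H h a (List.prefix_refl h) (by simp)
    have h2 := ih (h ++ [a]) fun g b h1 h2 =>
      H g b ((List.prefix_append h [a]).trans h1) (by simpa using h2)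
    exact ⟨mul_nonneg h1.1 h2.1, mul_le_one₀ h1.2 h2.1 h2.2⟩

theorem tendsto_pathProb {ι : Type*} {l : Filter ι} {F : ι → List A → A → ℝ}
    {f : List A → A → ℝ} (hF : ∀ g a, Tendsto (fun n => F n g a) l (𝓝 (f g a))) (w : List A) :
    ∀ h, Tendsto (fun n => pathProb (F n) h w) l (𝓝 (pathProb f h w)) := by
  induction w with
  | nil => intro h; exact tendsto_const_nhds
  | cons a w ih => intro h; exact (hF h a).mul (ih _)

theorem measurable_pathProb {α : Type*} [MeasurableSpace α] {F : α → List A → A → ℝ}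
    (hF : ∀ g a, Measurable fun x => F x g a) (w : List A) :
    ∀ h, Measurable fun x => pathProb (F x) h w := by
  induction w with
  | nil => intro h; exact measurable_const
  | cons a w ih => intro h; exact (hF h a).mul (ih _)

end PathProb

namespace Game

variable {A : Type u} {Info : Player → Type v}

/-! ### The game tree -/

section Tree

variable (G : Game A Info)

theorem mem_hist_of_prefix {g h : List A} (hgh : g <+: h) (hh : h ∈ G.hist) : g ∈ G.hist := by
  obtain ⟨w, rfl⟩ := hgh
  induction w using List.reverseRecOn with
  | nil => simpa using hh
  | append_singleton w a ih => exact ih (G.prefix_mem _ a (by simpa using hh))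

variable {G} in
theorem mem_acts {h : List A} {a : A} : a ∈ G.acts h ↔ h ++ [a] ∈ G.hist := mem_actsIn

variable {G} in
theorem mem_terminals {z : List A} : z ∈ G.terminals ↔ z ∈ G.hist ∧ G.acts z = ∅ := by
  simp [terminals]

theorem mem_acts_of_prefix {g h : List A} {a : A} (hgh : g ++ [a] <+: h) (hh : h ∈ G.hist) :
    a ∈ G.acts g :=
  mem_acts.2 (G.mem_hist_of_prefix hgh hh)

/-- Every node but the empty one is the successor of exactly one node. -/
theorem sum_hist_succ (F : List A → ℝ) :
    ∑ g ∈ G.hist, ∑ a ∈ G.acts g, F (g ++ [a]) = ∑ g ∈ G.hist, F g - F [] := by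
  have h1 : G.hist.erase [] = G.hist.biUnion fun g => (G.acts g).image fun a => g ++ [a] := by
    ext x
    simp only [Finset.mem_erase, Finset.mem_biUnion, Finset.mem_image, mem_acts]
    constructor
    · rintro ⟨hx, hxh⟩
      rcases List.eq_nil_or_concat x with rfl | ⟨w, b, rfl⟩
      · exact absurd rfl hx
      · simp only [List.concat_eq_append] at hxh ⊢
        exact ⟨w, G.prefix_mem _ b hxh, b, hxh, rfl⟩
    · rintro ⟨g, _, a, ha, rfl⟩
      exact ⟨by simp, ha⟩
  rw [← Finset.sum_erase_eq_sub G.nil_mem, h1, Finset.sum_biUnion]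
  · refine Finset.sum_congr rfl fun g _ => ?_
    rw [Finset.sum_image]
    intro a _ b _ e
    simpa using e
  · intro g _ g' _ hne
    simp only [Function.onFun, Finset.disjoint_left, Finset.mem_image]
    rintro x ⟨a, _, rfl⟩ ⟨b, _, e⟩
    exact hne (List.append_inj' e rfl).1.symm

end Tree

/-! ### Reach probabilities and values -/

section Value

variable (G : Game A Info) (σ : Profile A Info) (i : Player)

theorem reachFrom_self (h : List A) : G.reachFrom σ h h = 1 := by
  simp [reachFrom, pathProb]

theorem reachFrom_append (h w : List A) :
    G.reachFrom σ h (h ++ w) = pathProb (G.stepProb σ) h w := by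
  simp [reachFrom]

theorem reachFrom_of_not_prefix {h z : List A} (hz : ¬ h <+: z) : G.reachFrom σ h z = 0 := by
  simp [reachFrom, hz]

theorem reachFrom_nil_mul {d g : List A} (hdg : d <+: g) :
    G.reachFrom σ [] d * G.reachFrom σ d g = G.reachFrom σ [] g := by
  obtain ⟨w, rfl⟩ := hdg
  simp [reachFrom, pathProb_append]

/-- The correction term accounts for the play that starts at `g ++ [a]` itself. -/
theorem reachFrom_snoc (d g : List A) (a : A) : G.reachFrom σ d (g ++ [a]) =
    G.reachFrom σ d g * G.stepProb σ g a + if d = g ++ [a] then 1 else 0 := by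
  by_cases h : d <+: g
  · obtain ⟨w, rfl⟩ := h
    rw [List.append_assoc, reachFrom_append, reachFrom_append, pathProb_append_singleton, if_neg]
    · simp
    · intro e
      simpa using congrArg List.length e
  · rw [G.reachFrom_of_not_prefix σ h]
    by_cases e : d = g ++ [a]
    · subst e; simp [reachFrom_self]
    · rw [G.reachFrom_of_not_prefix, if_neg e]
      · simp
      · intro h'
        rcases List.prefix_concat_iff.1 h' with h' | h'
        · exact e (by simpa using h')
        · exact h h'

theorem value_of_acts_eq_empty {h : List A} (hh : h ∈ G.hist) (ha : G.acts h = ∅) :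
    G.value σ i h = G.util i h := by
  rw [value, Finset.sum_eq_single_of_mem h (mem_terminals.2 ⟨hh, ha⟩)]
  · rw [reachFrom_self, one_mul]
  · intro z hz hne
    rw [reachFrom_of_not_prefix, zero_mul]
    rintro ⟨w, rfl⟩
    cases w with
    | nil => simp at hne
    | cons b w =>
      have := G.mem_acts_of_prefix (g := h) (a := b) (by simp) (mem_terminals.1 hz).1
      simp [ha] at this

theorem value_eq_sum_acts {h : List A} (ha : (G.acts h).Nonempty) :
    G.value σ i h = ∑ a ∈ G.acts h, G.stepProb σ h a * G.value σ i (h ++ [a]) := by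
  simp only [value, Finset.mul_sum]
  rw [Finset.sum_comm]
  refine Finset.sum_congr rfl fun z hz => ?_
  simp only [← mul_assoc]
  rw [← Finset.sum_mul]
  congr 1
  by_cases h1 : h <+: z
  · obtain ⟨w, rfl⟩ := h1
    cases w with
    | nil =>
      have := (mem_terminals.1 hz).2
      simp [Finset.nonempty_iff_ne_empty] at ha this
      exact absurd this ha
    | cons b w =>
      rw [Finset.sum_eq_single b]
      · have := G.reachFrom_append σ (h ++ [b]) w
        rw [List.append_assoc, List.singleton_append] at this
        rw [this, reachFrom_append, pathProb]
      · intro a _ hab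
        rw [G.reachFrom_of_not_prefix, mul_zero]
        intro h2
        rw [List.prefix_append_right_inj] at h2
        simp at h2
        exact hab h2
      · intro hb
        exact absurd (G.mem_acts_of_prefix (by simp) (mem_terminals.1 hz).1) hb
  · rw [reachFrom_of_not_prefix _ _ h1]
    symm
    refine Finset.sum_eq_zero fun a _ => ?_
    rw [reachFrom_of_not_prefix, mul_zero]
    exact fun h2 => h1 ((List.prefix_append h [a]).trans h2)

/-- The performance difference identity: for a function `V` with the right terminal values, the
difference between the value of `d` and `V d` is the expected sum, along the play from `d`, of the
amounts by which `V` fails the one-step recursion of the value. -/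
theorem value_sub_eq (V : List A → ℝ) (hV : ∀ z ∈ G.terminals, V z = G.util i z) {d : List A}
    (hd : d ∈ G.hist) :
    G.value σ i d - V d = ∑ g ∈ G.hist, G.reachFrom σ d g *
      (∑ a ∈ G.acts g, G.stepProb σ g a * V (g ++ [a]) - if G.acts g = ∅ then 0 else V g) := by
  -- The sum over successors telescopes against the sum over nodes.
  have h1 : ∑ g ∈ G.hist, G.reachFrom σ d g *
      ∑ a ∈ G.acts g, G.stepProb σ g a * V (g ++ [a]) =
      ∑ g ∈ G.hist, G.reachFrom σ d g * V g - V d := by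
    have h2 := G.sum_hist_succ fun g => G.reachFrom σ d g * V g - if d = g then V d else 0
    have h3 : (G.reachFrom σ d [] * V [] - if d = [] then V d else 0) = 0 := by
      by_cases e : d = []
      · subst e; simp [reachFrom_self]
      · rw [reachFrom_of_not_prefix, if_neg e]
        · simp
        · simpa using e
    rw [h3, sub_zero, Finset.sum_sub_distrib, Finset.sum_ite_eq, if_pos hd] at h2
    rw [← h2]
    refine Finset.sum_congr rfl fun g _ => ?_
    rw [Finset.mul_sum]
    refine Finset.sum_congr rfl fun a _ => ?_
    rw [reachFrom_snoc]
    by_cases e : d = g ++ [a]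
    · simp only [e, if_true]; ring
    · simp only [e, if_false]; ring
  simp only [mul_sub, Finset.sum_sub_distrib]
  rw [h1]
  have h4 : ∑ g ∈ G.hist, G.reachFrom σ d g * (if G.acts g = ∅ then 0 else V g) =
      ∑ g ∈ G.hist, G.reachFrom σ d g * V g - G.value σ i d := by
    rw [value, terminals, Finset.sum_filter, ← Finset.sum_sub_distrib]
    refine Finset.sum_congr rfl fun g hg => ?_
    by_cases e : G.acts g = ∅
    · simp [e, hV g (mem_terminals.2 ⟨hg, e⟩)]
    · simp [e]
  rw [h4]
  ring

theorem value_two (h : List A) : G.value σ .two h = - G.value σ .one h := by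
  simp [value, util]

theorem reachOwn_mul_reachOther (h : List A) :
    G.reachOwn σ i h * G.reachOther σ i h = G.reachFrom σ [] h := by
  rw [reachOwn, reachOther, ← pathProb_mul]
  have h1 := G.reachFrom_append σ [] h
  rw [List.nil_append] at h1
  rw [h1]
  congr 1
  funext g a
  by_cases e : G.turn g = some i <;> simp [e]

theorem reachOwn_snoc (h : List A) (a : A) : G.reachOwn σ i (h ++ [a]) =
    G.reachOwn σ i h * if G.turn h = some i then σ i (G.info i h) a else 1 := by
  rw [reachOwn, reachOwn, pathProb_append_singleton]
  congr 1
  simp only [List.nil_append]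
  split_ifs with e
  · simp [stepProb, e]
  · rfl

variable {G σ i}

theorem stepProb_congr {τ : Profile A Info} {g : List A} {a : A}
    (h : ∀ j, G.turn g = some j → σ j (G.info j g) a = τ j (G.info j g) a) :
    G.stepProb σ g a = G.stepProb τ g a := by
  unfold stepProb
  cases e : G.turn g with
  | none => rfl
  | some j => exact h j e

theorem reachOwn_congr {τ : Profile A Info} (h : σ i = τ i) : G.reachOwn σ i = G.reachOwn τ i := by
  funext w
  unfold reachOwn
  congr 1
  funext g a
  split_ifs with e
  · simp [stepProb, e, h]
  · rfl

theorem reachOther_congr {τ : Profile A Info} (h : ∀ j, j ≠ i → σ j = τ j) :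
    G.reachOther σ i = G.reachOther τ i := by
  funext w
  unfold reachOther
  congr 1
  funext g a
  split_ifs with e
  · rfl
  · refine stepProb_congr fun j hj => ?_
    rw [h j]
    rintro rfl
    exact e hj

theorem reachFrom_congr {τ : Profile A Info} {d z : List A}
    (h : ∀ g a, d <+: g → g ++ [a] <+: z → ∀ j, G.turn g = some j →
      σ j (G.info j g) a = τ j (G.info j g) a) :
    G.reachFrom σ d z = G.reachFrom τ d z := by
  by_cases e : d <+: z
  · obtain ⟨w, rfl⟩ := e
    rw [reachFrom_append, reachFrom_append]
    exact pathProb_congr _ _ fun g a h1 h2 => stepProb_congr (h g a h1 h2)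
  · rw [reachFrom_of_not_prefix _ _ e, reachFrom_of_not_prefix _ _ e]

/-- The own contributions and those of chance and the opponent separate, so that the weighted
value is linear in the own contributions to reaching the terminal nodes. -/
theorem reachFrom_mul_value (i k : Player) (d : List A) : G.reachFrom σ [] d * G.value σ k d =
    ∑ z ∈ G.terminals with d <+: z, G.reachOwn σ i z * G.reachOther σ i z * G.util k z := by
  rw [value, Finset.mul_sum, Finset.sum_filter]
  refine Finset.sum_congr rfl fun z _ => ?_
  split_ifs with e
  · rw [← mul_assoc, reachFrom_nil_mul _ _ e, reachOwn_mul_reachOther]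
  · rw [reachFrom_of_not_prefix _ _ e]; ring

end Value

/-! ### Bounds for strategies -/

section Bounds

variable {G : Game A Info} {σ : Profile A Info} {i : Player}

theorem stepProb_nonneg (hσ : ∀ j, G.IsStrategy j (σ j)) {h : List A} (hh : h ∈ G.hist) {a : A}
    (ha : a ∈ G.acts h) : 0 ≤ G.stepProb σ h a := by
  unfold stepProb
  cases e : G.turn h with
  | none => exact G.chance_nonneg h hh e a ha
  | some j => exact (hσ j h hh e ⟨a, ha⟩).1 a

theorem sum_stepProb (hσ : ∀ j, G.IsStrategy j (σ j)) {h : List A} (hh : h ∈ G.hist)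
    (ha : (G.acts h).Nonempty) : ∑ a ∈ G.acts h, G.stepProb σ h a = 1 := by
  unfold stepProb
  cases e : G.turn h with
  | none => exact G.chance_sum h hh e ha
  | some j => exact (hσ j h hh e ha).2.2

theorem stepProb_mem_Icc (hσ : ∀ j, G.IsStrategy j (σ j)) {h : List A} (hh : h ∈ G.hist) {a : A}
    (ha : a ∈ G.acts h) : G.stepProb σ h a ∈ Set.Icc (0 : ℝ) 1 := by
  refine ⟨stepProb_nonneg hσ hh ha, ?_⟩
  rw [← sum_stepProb hσ hh ⟨a, ha⟩]
  exact Finset.single_le_sum (fun b hb => stepProb_nonneg hσ hh hb) ha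

theorem IsStrategy.mem_Icc {s : Strategy A (Info i)} (hs : G.IsStrategy i s) {h : List A}
    (hh : h ∈ G.hist) (ht : G.turn h = some i) (ha : (G.acts h).Nonempty) (a : A) :
    s (G.info i h) a ∈ Set.Icc (0 : ℝ) 1 := by
  obtain ⟨h1, h2, h3⟩ := hs h hh ht ha
  refine ⟨h1 a, ?_⟩
  by_cases hb : a ∈ G.acts h
  · rw [← h3]
    exact Finset.single_le_sum (fun b _ => h1 b) hb
  · rw [h2 a hb]; exact zero_le_one

theorem reachOwn_mem_Icc (hs : G.IsStrategy i (σ i)) {h : List A} (hh : h ∈ G.hist) :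
    G.reachOwn σ i h ∈ Set.Icc (0 : ℝ) 1 := by
  refine pathProb_mem_Icc _ _ _ fun g a _ hg => ?_
  rw [List.nil_append] at hg
  split_ifs with e
  · have := hs.mem_Icc (G.mem_hist_of_prefix ((List.prefix_append g [a]).trans hg) hh) e
      ⟨a, G.mem_acts_of_prefix hg hh⟩ a
    simpa [stepProb, e] using this
  · simp

theorem reachOther_mem_Icc (hσ : ∀ j, G.IsStrategy j (σ j)) {h : List A} (hh : h ∈ G.hist) :
    G.reachOther σ i h ∈ Set.Icc (0 : ℝ) 1 := by
  refine pathProb_mem_Icc _ _ _ fun g a _ hg => ?_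
  rw [List.nil_append] at hg
  split_ifs with e
  · simp
  · exact stepProb_mem_Icc hσ (G.mem_hist_of_prefix ((List.prefix_append g [a]).trans hg) hh)
      (G.mem_acts_of_prefix hg hh)

theorem reachFrom_mem_Icc (hσ : ∀ j, G.IsStrategy j (σ j)) (d : List A) {h : List A}
    (hh : h ∈ G.hist) : G.reachFrom σ d h ∈ Set.Icc (0 : ℝ) 1 := by
  unfold reachFrom
  split_ifs with e
  · obtain ⟨w, rfl⟩ := e
    rw [List.drop_left]
    exact pathProb_mem_Icc _ _ _ fun g a _ hg =>
      stepProb_mem_Icc hσ (G.mem_hist_of_prefix ((List.prefix_append g [a]).trans hg) hh)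
        (G.mem_acts_of_prefix hg hh)
  · simp

theorem abs_value_le (hσ : ∀ j, G.IsStrategy j (σ j)) (d : List A) :
    |G.value σ i d| ≤ ∑ z ∈ G.terminals, |G.util i z| := by
  refine (Finset.abs_sum_le_sum_abs _ _).trans (Finset.sum_le_sum fun z hz => ?_)
  have := reachFrom_mem_Icc hσ d (mem_terminals.1 hz).1
  rw [abs_mul, abs_of_nonneg this.1]
  exact mul_le_of_le_one_left (abs_nonneg _) this.2

end Bounds

/-! ### Information sets and perfect recall -/

section Infosets

variable {G : Game A Info} {i : Player}

theorem mem_infoset {J : Info i} {h : List A} :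
    h ∈ G.infoset i J ↔ h ∈ G.hist ∧ G.info i h = J := by
  simp [infoset]

theorem infosetActs_eq {h : List A} (hh : h ∈ G.hist) (ht : G.turn h = some i)
    (ha : (G.acts h).Nonempty) : G.infosetActs i (G.info i h) = G.acts h := by
  ext a
  simp only [infosetActs, Finset.mem_biUnion, mem_infoset]
  constructor
  · rintro ⟨g, ⟨hg, e⟩, hga⟩
    have := (G.info_acts i h hh g hg e.symm ht ha).2
    simpa only [acts, ← this] using hga
  · exact fun h1 => ⟨h, ⟨hh, rfl⟩, h1⟩

/-- Under perfect recall no player acts twice in the same information set. -/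
theorem PerfectRecall.info_ne (hG : G.PerfectRecall) : ∀ (n : ℕ) {g h : List A} {a : A},
    h.length = n → h ∈ G.hist → g ++ [a] <+: h → G.turn g = some i →
      G.info i g ≠ G.info i h := by
  intro n
  induction n using Nat.strong_induction_on with
  | _ n ih =>
    intro g h a hn hh hgh ht e
    have hg := G.mem_hist_of_prefix ((List.prefix_append g [a]).trans hgh) hh
    obtain ⟨g', hg', e', H⟩ := hG i h hh g hg e.symm g ((List.prefix_append g [a]).trans hgh)
    have hlen : g.length < h.length := by
      have := hgh.length_le
      simp at this
      omega
    -- Recall produces an earlier repetition, above `g` instead of above `h`: descend.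
    refine ih _ (hn ▸ hlen) rfl hg (H a ht hgh) ?_ e'
    exact (G.info_acts i g hg g' (G.mem_hist_of_prefix hg' hg) e'.symm ht
      ⟨a, G.mem_acts_of_prefix hgh hh⟩).1

/-- The information sets of player `i` in which `i` has acted on the way to a node, with the
actions chosen there. -/
def ownSeq (G : Game A Info) (i : Player) : List A → List A → List (Info i × A)
  | _, [] => []
  | h, a :: w => (if G.turn h = some i then [(G.info i h, a)] else []) ++ ownSeq G i (h ++ [a]) w

theorem ownSeq_append (w w' : List A) : ∀ h,
    G.ownSeq i h (w ++ w') = G.ownSeq i h w ++ G.ownSeq i (h ++ w) w' := by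
  induction w with
  | nil => intro h; simp [ownSeq]
  | cons a w ih => intro h; simp [ownSeq, ih]

theorem ownSeq_snoc (h : List A) (a : A) : G.ownSeq i [] (h ++ [a]) =
    G.ownSeq i [] h ++ if G.turn h = some i then [(G.info i h, a)] else [] := by
  simp [ownSeq_append, ownSeq]

theorem reachOwn_eq_prod_ownSeq (σ : Profile A Info) (h : List A) :
    G.reachOwn σ i h = ((G.ownSeq i [] h).map fun p => σ i p.1 p.2).prod := by
  induction h using List.reverseRecOn with
  | nil => simp [reachOwn, pathProb, ownSeq]
  | append_singleton h a ih =>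
    rw [reachOwn_snoc, ownSeq_snoc, ih]
    split_ifs <;> simp

theorem mem_ownSeq {h : List A} {p : Info i × A} : p ∈ G.ownSeq i [] h ↔
    ∃ g, g ++ [p.2] <+: h ∧ G.turn g = some i ∧ G.info i g = p.1 := by
  induction h using List.reverseRecOn with
  | nil => simp [ownSeq]
  | append_singleton h a ih =>
    rw [ownSeq_snoc, List.mem_append, ih]
    constructor
    · rintro (⟨g, h1, h2⟩ | h1)
      · exact ⟨g, h1.trans (List.prefix_append h [a]), h2⟩
      · split_ifs at h1 with e
        · rw [List.mem_singleton] at h1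
          subst h1
          exact ⟨h, List.prefix_refl _, e, rfl⟩
        · simp at h1
    · rintro ⟨g, h1, h2, h3⟩
      rcases List.prefix_concat_iff.1 h1 with h4 | h4
      · obtain ⟨rfl, h5⟩ := List.append_inj' h4 rfl
        right
        rw [if_pos h2, List.mem_singleton]
        ext
        · exact h3.symm
        · simpa using h5
      · exact Or.inl ⟨g, h4, h2, h3⟩

theorem PerfectRecall.nodup_ownSeq (hG : G.PerfectRecall) {h : List A} (hh : h ∈ G.hist) :
    (G.ownSeq i [] h).Nodup := by
  induction h using List.reverseRecOn with
  | nil => simp [ownSeq]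
  | append_singleton h a ih =>
    have hh' := G.prefix_mem h a hh
    rw [ownSeq_snoc, List.nodup_append]
    refine ⟨ih hh', by split_ifs <;> simp, ?_⟩
    intro p hp q hq e
    subst e
    split_ifs at hq with e
    · rw [List.mem_singleton] at hq
      subst hq
      obtain ⟨g, h1, h2, h3⟩ := mem_ownSeq.1 hp
      exact hG.info_ne _ rfl hh' h1 h2 h3
    · simp at hq

/-- Under perfect recall the own contribution to reaching a node depends on the information set
of the node only. -/
theorem PerfectRecall.reachOwn_eq (hG : G.PerfectRecall) (σ : Profile A Info) {h h' : List A}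
    (hh : h ∈ G.hist) (hh' : h' ∈ G.hist) (e : G.info i h = G.info i h') :
    G.reachOwn σ i h = G.reachOwn σ i h' := by
  rw [reachOwn_eq_prod_ownSeq, reachOwn_eq_prod_ownSeq]
  refine List.Perm.prod_eq (List.Perm.map _ ?_)
  rw [List.perm_ext_iff_of_nodup (hG.nodup_ownSeq hh) (hG.nodup_ownSeq hh')]
  have key : ∀ h ∈ G.hist, ∀ h' ∈ G.hist, G.info i h = G.info i h' → ∀ p,
      p ∈ G.ownSeq i [] h → p ∈ G.ownSeq i [] h' := by
    intro h hh h' hh' e p hp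
    obtain ⟨g, h1, h2, h3⟩ := mem_ownSeq.1 hp
    have hg := (List.prefix_append g [p.2]).trans h1
    obtain ⟨g', h4, h5, h6⟩ := hG i h hh h' hh' e g hg
    refine mem_ownSeq.2 ⟨g', h6 _ h2 h1, ?_, h5.trans h3⟩
    exact (G.info_acts i g (G.mem_hist_of_prefix hg hh) g' (G.mem_hist_of_prefix h4 hh') h5.symm h2
      ⟨_, G.mem_acts_of_prefix h1 hh⟩).1
  exact fun p => ⟨key h hh h' hh' e p, key h' hh' h hh e.symm p⟩

theorem PerfectRecall.infosetReach_eq (hG : G.PerfectRecall) (σ : Profile A Info) {h : List A}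
    (hh : h ∈ G.hist) : G.infosetReach σ i (G.info i h) = G.reachOwn σ i h := by
  have hm : h ∈ G.infoset i (G.info i h) := mem_infoset.2 ⟨hh, rfl⟩
  rw [infosetReach, Finset.sum_congr rfl fun g hg =>
    hG.reachOwn_eq σ (mem_infoset.1 hg).1 hh (mem_infoset.1 hg).2, Finset.sum_const, nsmul_eq_mul,
    mul_div_cancel_left₀]
  exact_mod_cast (Finset.card_pos.2 ⟨h, hm⟩).ne'

end Infosets

/-! ### Average strategies -/

section Average

variable {G : Game A Info} {i : Player}

/-- The average strategy of player `i` over `T` profiles, each weighted by the contribution of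
`i` to reaching the information set. -/
def averageStrategy (G : Game A Info) (τ : ℕ → Profile A Info) (T : ℕ) (i : Player) :
    Strategy A (Info i) := fun J a =>
  if (∑ t ∈ Finset.range T, G.infosetReach (τ t) i J) = 0 then
    if a ∈ G.infosetActs i J then 1 / (G.infosetActs i J).card else 0
  else
    (∑ t ∈ Finset.range T, G.infosetReach (τ t) i J * τ t i J a) /
      ∑ t ∈ Finset.range T, G.infosetReach (τ t) i J

theorem isStrategy_averageStrategy (hG : G.PerfectRecall) {τ : ℕ → Profile A Info}
    (hτ : ∀ t, G.IsStrategy i (τ t i)) (T : ℕ) : G.IsStrategy i (G.averageStrategy τ T i) := by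
  intro h hh ht ha
  have hr : ∀ t, 0 ≤ G.infosetReach (τ t) i (G.info i h) := fun t => by
    rw [hG.infosetReach_eq _ hh]
    exact (reachOwn_mem_Icc (hτ t) hh).1
  unfold averageStrategy
  rw [infosetActs_eq hh ht ha]
  split_ifs with e
  · refine ⟨fun a => by split_ifs <;> positivity, fun a h1 => by simp [h1], ?_⟩
    rw [Finset.sum_const, nsmul_eq_mul, mul_one_div, div_self]
    exact_mod_cast (Finset.card_pos.2 ha).ne'
  · refine ⟨fun a => div_nonneg (Finset.sum_nonneg fun t _ =>
      mul_nonneg (hr t) ((hτ t h hh ht ha).1 a)) (Finset.sum_nonneg fun t _ => hr t), ?_, ?_⟩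
    · intro a h1
      rw [Finset.sum_eq_zero, zero_div]
      intro t _
      rw [(hτ t h hh ht ha).2.1 a h1, mul_zero]
    · rw [← Finset.sum_div, Finset.sum_comm, div_eq_one_iff_eq e]
      refine Finset.sum_congr rfl fun t _ => ?_
      rw [← Finset.mul_sum, (hτ t h hh ht ha).2.2, mul_one]

/-- The bound holds at the names of all information sets, also of those that do not occur. -/
theorem averageStrategy_mem_Icc {τ : ℕ → Profile A Info} (hτ : ∀ t, G.IsStrategy i (τ t i))
    (h01 : ∀ t J a, τ t i J a ∈ Set.Icc (0 : ℝ) 1) (T : ℕ) (J : Info i) (a : A) :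
    G.averageStrategy τ T i J a ∈ Set.Icc (0 : ℝ) 1 := by
  have hr : ∀ t, 0 ≤ G.infosetReach (τ t) i J := fun t =>
    div_nonneg (Finset.sum_nonneg fun h hh => (reachOwn_mem_Icc (hτ t) (mem_infoset.1 hh).1).1)
      (Nat.cast_nonneg _)
  have hr' : 0 ≤ ∑ t ∈ Finset.range T, G.infosetReach (τ t) i J :=
    Finset.sum_nonneg fun t _ => hr t
  unfold averageStrategy
  split_ifs with h1 h2
  · rw [one_div]
    exact ⟨by positivity, Nat.cast_inv_le_one _⟩
  · simp
  · exact ⟨div_nonneg (Finset.sum_nonneg fun t _ => mul_nonneg (hr t) (h01 t J a).1) hr',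
      div_le_one_of_le₀ (Finset.sum_le_sum fun t _ =>
        mul_le_of_le_one_right (hr t) (h01 t J a).2) hr'⟩

/-- Playing the average strategy amounts to drawing one of the averaged strategies uniformly at
random, in terms of the contributions to reaching each node. -/
theorem reachOwn_averageStrategy (hG : G.PerfectRecall) {τ : ℕ → Profile A Info}
    (hτ : ∀ t, G.IsStrategy i (τ t i)) {T : ℕ} {ρ : Profile A Info}
    (hρ : ρ i = G.averageStrategy τ T i) {h : List A} (hh : h ∈ G.hist) :
    T * G.reachOwn ρ i h = ∑ t ∈ Finset.range T, G.reachOwn (τ t) i h := by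
  induction h using List.reverseRecOn with
  | nil => simp [reachOwn, pathProb]
  | append_singleton h a ih =>
    have hh' := G.prefix_mem h a hh
    specialize ih hh'
    rw [reachOwn_snoc, ← mul_assoc, ih]
    simp only [reachOwn_snoc]
    split_ifs with e
    · rw [hρ]
      unfold averageStrategy
      simp only [hG.infosetReach_eq _ hh']
      by_cases h0 : ∑ t ∈ Finset.range T, G.reachOwn (τ t) i h = 0
      · rw [h0, zero_mul]
        rw [Finset.sum_eq_zero_iff_of_nonneg fun t _ => (reachOwn_mem_Icc (hτ t) hh').1] at h0
        exact (Finset.sum_eq_zero fun t ht => by rw [h0 t ht, zero_mul]).symm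
      · rw [if_neg h0, mul_div_cancel₀ _ h0]
    · simp

/-- Against fixed opponents, the reach-weighted value of a node under the average strategy is the
mean of those under the averaged strategies. -/
theorem reach_mul_value_averageStrategy (hG : G.PerfectRecall) {τ : ℕ → Profile A Info}
    (hτ : ∀ t, G.IsStrategy i (τ t i)) {T : ℕ} {ρ : Profile A Info} {ρ' : ℕ → Profile A Info}
    (hρ : ρ i = G.averageStrategy τ T i) (hρ' : ∀ t, ρ' t i = τ t i)
    (hρρ' : ∀ t j, j ≠ i → ρ' t j = ρ j) (k : Player) (d : List A) :
    T * (G.reachFrom ρ [] d * G.value ρ k d) =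
      ∑ t ∈ Finset.range T, G.reachFrom (ρ' t) [] d * G.value (ρ' t) k d := by
  simp only [reachFrom_mul_value i k d]
  rw [Finset.mul_sum, Finset.sum_comm]
  refine Finset.sum_congr rfl fun z hz => ?_
  have hz := (mem_terminals.1 (Finset.mem_filter.1 hz).1).1
  rw [← mul_assoc, ← mul_assoc, reachOwn_averageStrategy hG hτ hρ hz, Finset.sum_mul,
    Finset.sum_mul]
  exact Finset.sum_congr rfl fun t _ => by
    rw [reachOwn_congr (hρ' t), reachOther_congr (hρρ' t)]

end Average

end Game

namespace Game

variable {A : Type u} {Info : Player → Type v}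

/-! ### Decomposition of regret over information sets -/

section Decomposition

variable {G : Game A Info} {i : Player}

/-- The decision nodes of player `i` at or below one of the nodes in `D`. -/
def decisionsBelow (G : Game A Info) (i : Player) (D : Finset (List A)) : Finset (List A) :=
  G.hist.filter fun g => G.turn g = some i ∧ (G.acts g).Nonempty ∧ ∃ d ∈ D, d <+: g

theorem mem_decisionsBelow {D : Finset (List A)} {g : List A} : g ∈ G.decisionsBelow i D ↔
    g ∈ G.hist ∧ G.turn g = some i ∧ (G.acts g).Nonempty ∧ ∃ d ∈ D, d <+: g := by
  simp [decisionsBelow]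

/-- `D` is a set of nodes, none above another, such that an information set in which player `i`
acts lies below `D` as soon as one of its nodes does. -/
structure IsCut (G : Game A Info) (i : Player) (D : Finset (List A)) : Prop where
  subset : D ⊆ G.hist
  eq_of_prefix : ∀ d ∈ D, ∀ d' ∈ D, ∀ g, d <+: g → d' <+: g → d = d'
  info_mem : ∀ g ∈ G.decisionsBelow i D, ∀ g' ∈ G.hist, G.info i g' = G.info i g →
    ∃ d ∈ D, d <+: g'

/-- The values under `σ` fail the one-step recursion for `τ` only where the deviating player
acts. -/
theorem step_sub_value {σ τ : Profile A Info} (hτ : ∀ j, j ≠ i → τ j = σ j)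
    (hs : G.IsStrategy i (τ i)) {g : List A} (hg : g ∈ G.hist) :
    (∑ a ∈ G.acts g, G.stepProb τ g a * G.value σ i (g ++ [a]) -
      if G.acts g = ∅ then 0 else G.value σ i g) =
    if G.turn g = some i ∧ (G.acts g).Nonempty then
      ∑ a ∈ G.acts g, τ i (G.info i g) a * (G.value σ i (g ++ [a]) - G.value σ i g) else 0 := by
  rcases Finset.eq_empty_or_nonempty (G.acts g) with e | e
  · simp [e]
  · rw [if_neg e.ne_empty]
    by_cases ht : G.turn g = some i
    · rw [if_pos ⟨ht, e⟩]
      simp only [mul_sub, Finset.sum_sub_distrib]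
      rw [← Finset.sum_mul, (hs g hg ht e).2.2, one_mul]
      simp [stepProb, ht]
    · rw [if_neg fun h => ht h.1, G.value_eq_sum_acts σ i e, sub_eq_zero]
      refine Finset.sum_congr rfl fun a _ => ?_
      rw [stepProb_congr (σ := τ) (τ := σ)]
      intro j hj
      rw [hτ j]
      rintro rfl
      exact ht hj

/-- The gain of a deviation of player `i`, accumulated over the nodes of a cut, is the sum over
the information sets below the cut of the instantaneous counterfactual regrets of the actions to
which `i` deviates there, weighted by the own contribution of the deviation to reaching them. -/
theorem sum_reach_mul_value_sub (hG : G.PerfectRecall) {σ τ : Profile A Info}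
    (hτ : ∀ j, j ≠ i → τ j = σ j) (hs : G.IsStrategy i (τ i)) {D : Finset (List A)}
    (hD : G.IsCut i D) :
    ∑ d ∈ D, G.reachFrom τ [] d * (G.value τ i d - G.value σ i d) =
      ∑ J ∈ (G.decisionsBelow i D).image (G.info i), G.infosetReach τ i J *
        ∑ a ∈ G.infosetActs i J, τ i J a * G.instRegret σ i J a := by
  set B : List A → ℝ := fun g =>
    ∑ a ∈ G.acts g, τ i (G.info i g) a * (G.value σ i (g ++ [a]) - G.value σ i g) with hB
  have h1 : ∑ d ∈ D, G.reachFrom τ [] d * (G.value τ i d - G.value σ i d) =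
      ∑ g ∈ G.decisionsBelow i D, G.reachFrom τ [] g * B g := by
    calc _ = ∑ d ∈ D, ∑ g ∈ G.hist, G.reachFrom τ [] d * (G.reachFrom τ d g *
          if G.turn g = some i ∧ (G.acts g).Nonempty then B g else 0) := by
          refine Finset.sum_congr rfl fun d hd => ?_
          rw [G.value_sub_eq τ i (G.value σ i) (fun z hz => G.value_of_acts_eq_empty σ i
            (mem_terminals.1 hz).1 (mem_terminals.1 hz).2) (hD.subset hd), Finset.mul_sum]
          exact Finset.sum_congr rfl fun g hg => by rw [step_sub_value hτ hs hg]
      _ = _ := by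
          rw [Finset.sum_comm, decisionsBelow, Finset.sum_filter]
          refine Finset.sum_congr rfl fun g hg => ?_
          by_cases hd : ∃ d ∈ D, d <+: g
          · obtain ⟨d, hd, hdg⟩ := hd
            rw [Finset.sum_eq_single_of_mem d hd, ← mul_assoc, reachFrom_nil_mul _ _ hdg]
            · by_cases e : G.turn g = some i ∧ (G.acts g).Nonempty
              · rw [if_pos e, if_pos ⟨e.1, e.2, d, hd, hdg⟩]
              · rw [if_neg e, if_neg fun h => e ⟨h.1, h.2.1⟩, mul_zero]
            · intro d' hd' hne
              rw [G.reachFrom_of_not_prefix τ (h := d'), zero_mul, mul_zero]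
              exact fun h => hne (hD.eq_of_prefix _ hd' _ hd g h hdg)
          · refine (Finset.sum_eq_zero fun d' hd' => ?_).trans (if_neg fun h => hd h.2.2).symm
            rw [G.reachFrom_of_not_prefix τ (h := d'), zero_mul, mul_zero]
            exact fun h => hd ⟨d', hd', h⟩
  rw [h1, ← Finset.sum_fiberwise_of_maps_to (g := G.info i)
    (fun g hg => Finset.mem_image_of_mem _ hg)]
  refine Finset.sum_congr rfl fun J hJ => ?_
  obtain ⟨g₀, hg₀, rfl⟩ := Finset.mem_image.1 hJ
  obtain ⟨hm, ht, ha, -⟩ := mem_decisionsBelow.1 hg₀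
  have h2 : (G.decisionsBelow i D).filter (fun g => G.info i g = G.info i g₀) =
      G.infoset i (G.info i g₀) := by
    ext g
    rw [Finset.mem_filter, mem_decisionsBelow, mem_infoset]
    constructor
    · exact fun h => ⟨h.1.1, h.2⟩
    · rintro ⟨hg, e⟩
      have h3 := G.info_acts i g₀ hm g hg e.symm ht ha
      refine ⟨⟨hg, h3.1, ?_, hD.info_mem _ hg₀ g hg e⟩, e⟩
      rw [acts, h3.2]
      exact ha
  rw [h2]
  simp only [instRegret, Finset.mul_sum]
  rw [Finset.sum_comm (s := G.infosetActs i (G.info i g₀))]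
  refine Finset.sum_congr rfl fun g hg => ?_
  obtain ⟨hg, e⟩ := mem_infoset.1 hg
  rw [hB, infosetActs_eq hm ht ha, Finset.mul_sum]
  have h3 := (G.info_acts i g₀ hm g hg e.symm ht ha).2
  rw [show G.acts g = G.acts g₀ from h3]
  refine Finset.sum_congr rfl fun a _ => ?_
  rw [← reachOwn_mul_reachOther G τ i g, ← e, hG.infosetReach_eq _ hg,
    reachOther_congr (σ := τ) (τ := σ) hτ]
  ring

end Decomposition

/-! ### Regret matching -/

section RegretMatching

variable {G : Game A Info} {i : Player}

theorem isStrategy_regretMatching (R : Profile A Info) : G.IsStrategy i (G.regretMatching R i) := by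
  intro h hh ht ha
  unfold regretMatching
  rw [infosetActs_eq hh ht ha]
  refine ⟨fun a => ?_, fun a h1 => if_neg h1, ?_⟩
  · split_ifs with h1 h2
    · exact div_nonneg (le_max_right _ _) h2.le
    · positivity
    · exact le_rfl
  · rw [Finset.sum_congr rfl fun a h1 => if_pos h1]
    split_ifs with h2
    · rw [← Finset.sum_div, div_self h2.ne']
    · rw [Finset.sum_const, nsmul_eq_mul, mul_one_div, div_self]
      exact_mod_cast (Finset.card_pos.2 ha).ne'

theorem regretMatching_mem_Icc (R : Profile A Info) (J : Info i) (a : A) :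
    G.regretMatching R i J a ∈ Set.Icc (0 : ℝ) 1 := by
  unfold regretMatching
  split_ifs with h1 h2
  · exact ⟨div_nonneg (le_max_right _ _) h2.le, (div_le_one h2).2
      (Finset.single_le_sum (f := fun b => max (R i J b) 0) (fun _ _ => le_max_right _ _) h1)⟩
  · rw [one_div]
    exact ⟨by positivity, Nat.cast_inv_le_one _⟩
  · simp

/-- A bound on all instantaneous counterfactual regrets of player `i`. -/
def regretBound (G : Game A Info) (i : Player) : ℝ :=
  G.hist.card * (2 * ∑ z ∈ G.terminals, |G.util i z|)

theorem abs_instRegret_le {σ : Profile A Info} (hσ : ∀ j, G.IsStrategy j (σ j)) (J : Info i)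
    (a : A) : |G.instRegret σ i J a| ≤ G.regretBound i := by
  have hU : 0 ≤ ∑ z ∈ G.terminals, |G.util i z| := Finset.sum_nonneg fun z _ => abs_nonneg _
  calc |G.instRegret σ i J a|
      ≤ ∑ h ∈ G.infoset i J, 2 * ∑ z ∈ G.terminals, |G.util i z| := by
        refine (Finset.abs_sum_le_sum_abs _ _).trans (Finset.sum_le_sum fun h hh => ?_)
        have h1 := reachOther_mem_Icc (i := i) hσ (mem_infoset.1 hh).1
        rw [abs_mul, abs_of_nonneg h1.1]
        refine (mul_le_of_le_one_left (abs_nonneg _) h1.2).trans ((abs_sub _ _).trans ?_)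
        have := abs_value_le (i := i) hσ (h ++ [a])
        have := abs_value_le (i := i) hσ h
        linarith
    _ ≤ G.regretBound i := by
        rw [Finset.sum_const, nsmul_eq_mul, regretBound]
        refine mul_le_mul_of_nonneg_right ?_ (by positivity)
        exact_mod_cast Finset.card_le_card (Finset.filter_subset _ _)

/-- The instantaneous regrets in an information set average to zero under the strategy played
there. -/
theorem sum_mul_instRegret_eq_zero {σ : Profile A Info} (hσ : G.IsStrategy i (σ i))
    {g : List A} (hg : g ∈ G.hist) (ht : G.turn g = some i) (ha : (G.acts g).Nonempty) :
    ∑ a ∈ G.infosetActs i (G.info i g), σ i (G.info i g) a * G.instRegret σ i (G.info i g) a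
      = 0 := by
  simp only [instRegret, Finset.mul_sum]
  rw [Finset.sum_comm]
  refine Finset.sum_eq_zero fun h hh => ?_
  obtain ⟨hh, e⟩ := mem_infoset.1 hh
  obtain ⟨h1, h2⟩ := G.info_acts i g hg h hh e.symm ht ha
  have h3 : G.acts h = G.acts g := h2
  have h4 := G.value_eq_sum_acts σ i (h := h) (h3 ▸ ha)
  rw [infosetActs_eq hg ht ha, ← h3]
  have h5 : ∑ a ∈ G.acts h, σ i (G.info i g) a *
      (G.value σ i (h ++ [a]) - G.value σ i h) = 0 := by
    simp only [mul_sub, Finset.sum_sub_distrib]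
    rw [← Finset.sum_mul, h3, (hσ g hg ht ha).2.2, one_mul, ← h3, sub_eq_zero, h4]
    refine Finset.sum_congr rfl fun a _ => ?_
    simp [stepProb, h1, e]
  calc _ = G.reachOther σ i h * ∑ a ∈ G.acts h, σ i (G.info i g) a *
      (G.value σ i (h ++ [a]) - G.value σ i h) := by
        rw [Finset.mul_sum]
        exact Finset.sum_congr rfl fun a _ => by ring
    _ = 0 := by rw [h5, mul_zero]

variable {patch : Profile A Info → Profile A Info}

theorem isStrategy_cfrProfile
    (hpatch : ∀ τ : Profile A Info, (∀ j, G.IsStrategy j (τ j)) → ∀ j, G.IsStrategy j (patch τ j))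
    (t : ℕ) (j : Player) : G.IsStrategy j (G.cfrProfile patch t j) :=
  hpatch _ (fun _ => isStrategy_regretMatching _) j

/-- Blackwell's condition: the instantaneous regrets are orthogonal to the positive parts of the
cumulative regrets that regret matching has used. -/
theorem sum_max_mul_instRegret_eq_zero (hpatch : ∀ τ : Profile A Info,
    (∀ j, G.IsStrategy j (τ j)) → ∀ j, G.IsStrategy j (patch τ j)) {g : List A}
    (hg : g ∈ G.hist) (ht : G.turn g = some i) (ha : (G.acts g).Nonempty)
    (hpg : ∀ τ : Profile A Info, patch τ i (G.info i g) = τ i (G.info i g)) (t : ℕ) :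
    ∑ a ∈ G.infosetActs i (G.info i g), max (G.cfrRegret patch t i (G.info i g) a) 0 *
      G.instRegret (G.cfrProfile patch t) i (G.info i g) a = 0 := by
  have h0 := sum_mul_instRegret_eq_zero (isStrategy_cfrProfile hpatch t i) hg ht ha
  set R := G.cfrRegret patch t
  set J := G.info i g
  have h1 : ∀ a ∈ G.infosetActs i J, G.cfrProfile patch t i J a =
      if 0 < ∑ b ∈ G.infosetActs i J, max (R i J b) 0 then
      max (R i J a) 0 / ∑ b ∈ G.infosetActs i J, max (R i J b) 0
      else 1 / (G.infosetActs i J).card := by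
    intro a h
    rw [cfrProfile, hpg, regretMatching, if_pos h]
  rw [Finset.sum_congr rfl fun a h => by rw [h1 a h]] at h0
  split_ifs at h0 with hp
  · rw [Finset.sum_congr rfl fun a _ => div_mul_eq_mul_div _ _ _, ← Finset.sum_div,
      div_eq_zero_iff] at h0
    exact h0.resolve_right hp.ne'
  · have h2 : ∑ b ∈ G.infosetActs i J, max (R i J b) 0 = 0 :=
      le_antisymm (not_lt.1 hp) (Finset.sum_nonneg fun _ _ => le_max_right _ _)
    rw [Finset.sum_eq_zero_iff_of_nonneg fun _ _ => le_max_right _ _] at h2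
    exact Finset.sum_eq_zero fun a h => by rw [h2 a h, zero_mul]

theorem max_add_sq_le (x r : ℝ) : max (x + r) 0 ^ 2 ≤ max x 0 ^ 2 + 2 * (max x 0 * r) + r ^ 2 := by
  have h1 : max (x + r) 0 ≤ |max x 0 + r| :=
    max_le ((add_le_add_left (le_max_left _ _) _).trans (le_abs_self _)) (abs_nonneg _)
  calc max (x + r) 0 ^ 2 ≤ |max x 0 + r| ^ 2 := pow_le_pow_left₀ (le_max_right _ _) h1 2
    _ = _ := by rw [sq_abs]; ring

/-- The regret-matching potential grows at most linearly. -/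
theorem sum_max_cfrRegret_sq_le (hpatch : ∀ τ : Profile A Info,
    (∀ j, G.IsStrategy j (τ j)) → ∀ j, G.IsStrategy j (patch τ j)) {g : List A}
    (hg : g ∈ G.hist) (ht : G.turn g = some i) (ha : (G.acts g).Nonempty)
    (hpg : ∀ τ : Profile A Info, patch τ i (G.info i g) = τ i (G.info i g)) (T : ℕ) :
    ∑ a ∈ G.infosetActs i (G.info i g), max (G.cfrRegret patch T i (G.info i g) a) 0 ^ 2 ≤
      T * ((G.infosetActs i (G.info i g)).card * G.regretBound i ^ 2) := by
  induction T with
  | zero => simp [cfrRegret]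
  | succ T ih =>
    have h0 := sum_max_mul_instRegret_eq_zero hpatch hg ht ha hpg T
    set J := G.info i g
    calc _ ≤ ∑ a ∈ G.infosetActs i J, (max (G.cfrRegret patch T i J a) 0 ^ 2 +
          2 * (max (G.cfrRegret patch T i J a) 0 * G.instRegret (G.cfrProfile patch T) i J a) +
          G.regretBound i ^ 2) := by
          refine Finset.sum_le_sum fun a _ => (max_add_sq_le _ _).trans ?_
          refine add_le_add le_rfl ?_
          rw [← sq_abs]
          exact pow_le_pow_left₀ (abs_nonneg _)
            (abs_instRegret_le (isStrategy_cfrProfile hpatch T) J a) 2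
      _ ≤ _ := by
          rw [Finset.sum_add_distrib, Finset.sum_add_distrib, ← Finset.mul_sum, h0,
            Finset.sum_const, nsmul_eq_mul]
          push_cast
          linarith

theorem sum_max_cfrRegret_le (hpatch : ∀ τ : Profile A Info,
    (∀ j, G.IsStrategy j (τ j)) → ∀ j, G.IsStrategy j (patch τ j)) {g : List A}
    (hg : g ∈ G.hist) (ht : G.turn g = some i) (ha : (G.acts g).Nonempty)
    (hpg : ∀ τ : Profile A Info, patch τ i (G.info i g) = τ i (G.info i g)) (T : ℕ) :
    ∑ a ∈ G.infosetActs i (G.info i g), max (G.cfrRegret patch T i (G.info i g) a) 0 ≤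
      (G.infosetActs i (G.info i g)).card * G.regretBound i * √T := by
  have h0 := sum_max_cfrRegret_sq_le hpatch hg ht ha hpg T
  set J := G.info i g
  have hb : 0 ≤ G.regretBound i := by
    unfold regretBound
    have : 0 ≤ ∑ z ∈ G.terminals, |G.util i z| := Finset.sum_nonneg fun z _ => abs_nonneg _
    positivity
  refine (sq_le_sq₀ (Finset.sum_nonneg fun _ _ => le_max_right _ _) (by positivity)).1 ?_
  calc _ ≤ ((G.infosetActs i J).card : ℝ) *
        ∑ a ∈ G.infosetActs i J, max (G.cfrRegret patch T i J a) 0 ^ 2 := sq_sum_le_card_mul_sum_sq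
    _ ≤ (G.infosetActs i J).card * (T * ((G.infosetActs i J).card * G.regretBound i ^ 2)) :=
        mul_le_mul_of_nonneg_left h0 (Nat.cast_nonneg _)
    _ = _ := by
        rw [mul_pow, mul_pow, Real.sq_sqrt (Nat.cast_nonneg _)]
        ring

theorem cfrRegret_eq_sum (T : ℕ) (J : Info i) (a : A) : G.cfrRegret patch T i J a =
    ∑ t ∈ Finset.range T, G.instRegret (G.cfrProfile patch t) i J a := by
  induction T with
  | zero => rfl
  | succ T ih => rw [Finset.sum_range_succ, ← ih]; rfl

/-- Counterfactual regret minimization has sublinear regret below every cut under which the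
profile is left unmodified. -/
theorem exists_cfr_regret_le (hG : G.PerfectRecall) (hpatch : ∀ τ : Profile A Info,
    (∀ j, G.IsStrategy j (τ j)) → ∀ j, G.IsStrategy j (patch τ j)) {D : Finset (List A)}
    (hD : G.IsCut i D) (hpD : ∀ g ∈ G.decisionsBelow i D, ∀ τ : Profile A Info,
      patch τ i (G.info i g) = τ i (G.info i g)) :
    ∃ C : ℝ, ∀ (T : ℕ) (τ : ℕ → Profile A Info), G.IsStrategy i (τ 0 i) →
      (∀ t, τ t i = τ 0 i) → (∀ t j, j ≠ i → τ t j = G.cfrProfile patch t j) →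
      ∑ t ∈ Finset.range T, ∑ d ∈ D, G.reachFrom (τ t) [] d *
        (G.value (τ t) i d - G.value (G.cfrProfile patch t) i d) ≤ C * √T := by
  refine ⟨∑ J ∈ (G.decisionsBelow i D).image (G.info i),
    (G.infosetActs i J).card * G.regretBound i, fun T τ hs hi hj => ?_⟩
  rw [Finset.sum_congr rfl fun t _ => sum_reach_mul_value_sub hG (hj t) (by rwa [hi t]) hD,
    Finset.sum_comm, Finset.sum_mul]
  refine Finset.sum_le_sum fun J hJ => ?_
  obtain ⟨g, hg, rfl⟩ := Finset.mem_image.1 hJ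
  obtain ⟨hm, ht, ha, -⟩ := mem_decisionsBelow.1 hg
  refine le_trans ?_ (sum_max_cfrRegret_le hpatch hm ht ha (hpD g hg) T)
  have h1 : ∀ t, G.infosetReach (τ t) i (G.info i g) = G.reachOwn (τ 0) i g := fun t => by
    rw [hG.infosetReach_eq _ hm, reachOwn_congr (hi t)]
  have h2 := reachOwn_mem_Icc hs hm
  simp only [h1, hi]
  rw [← Finset.mul_sum, Finset.sum_comm]
  simp only [← Finset.mul_sum, ← cfrRegret_eq_sum]
  rw [Finset.mul_sum]
  refine Finset.sum_le_sum fun a _ => ?_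
  have h3 := hs.mem_Icc hm ht ha a
  rw [← mul_assoc]
  calc _ ≤ G.reachOwn (τ 0) i g * τ 0 i (G.info i g) a *
        max (G.cfrRegret patch T i (G.info i g) a) 0 :=
        mul_le_mul_of_nonneg_left (le_max_left _ _) (mul_nonneg h2.1 h3.1)
    _ ≤ _ := mul_le_of_le_one_left (le_max_right _ _) (mul_le_one₀ h2.2 h3.1 h3.2)

end RegretMatching

end Game

namespace Game

variable {A : Type u} {Info : Player → Type v} {G : Game A Info}

theorem mkProfile_one (s₁ : Strategy A (Info .one)) (s₂ : Strategy A (Info .two)) :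
    mkProfile s₁ s₂ .one = s₁ :=
  rfl

theorem mkProfile_two (s₁ : Strategy A (Info .one)) (s₂ : Strategy A (Info .two)) :
    mkProfile s₁ s₂ .two = s₂ :=
  rfl

/-! ### The augmented subgame -/

section Nodes

variable {S : G.Subgame}

theorem top_subset_hist {h : List A} (hh : h ∈ S.top) : h ∈ G.hist :=
  S.subset (Finset.mem_filter.1 hh).1

theorem append_mem_nodes {h w : List A} (hh : h ∈ S.top) (hw : h ++ w ∈ G.hist) :
    h ++ w ∈ S.nodes :=
  S.desc_mem h (Finset.mem_filter.1 hh).1 _ hw (List.prefix_append h w)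

theorem top_prefix_of_mem {h g x : List A} (hh : h ∈ S.top) (hg : g ∈ S.nodes) (hhx : h <+: x)
    (hgx : g <+: x) : h <+: g := by
  rcases List.prefix_or_prefix_of_prefix hhx hgx with e | e
  · exact e
  · rw [(Finset.mem_filter.1 hh).2 g e hg]

/-- Player one's information set of a node of the subgame determines the information set of the
earliest-reachable node above. -/
theorem info_top_eq (hG : G.PerfectRecall) {h h' w w' : List A} (hh : h ∈ S.top)
    (hh' : h' ∈ S.top) (hw : h ++ w ∈ G.hist) (hw' : h' ++ w' ∈ G.hist) {i : Player}
    (e : G.info i (h ++ w) = G.info i (h' ++ w')) : G.info i h = G.info i h' := by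
  obtain ⟨g, hg, e1, -⟩ := hG i _ hw _ hw' e h (List.prefix_append h w)
  have hgS := S.info_mem i h (Finset.mem_filter.1 hh).1 g (G.mem_hist_of_prefix hg hw') e1
  have h1 := top_prefix_of_mem hh' hgS (List.prefix_append h' w') hg
  obtain ⟨g', hg', e2, -⟩ := hG i g (S.subset hgS) h (top_subset_hist hh) e1 h' h1
  have hg'S := S.info_mem i h' (Finset.mem_filter.1 hh').1 g'
    (G.mem_hist_of_prefix hg' (top_subset_hist hh)) e2
  rw [← e2, (Finset.mem_filter.1 hh).2 g' hg' hg'S]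

theorem prefix_start {h : List A} {g : List (AugAct A)} (hg : g <+: [AugAct.start h]) :
    g = [] ∨ g = [AugAct.start h] := by
  rcases List.prefix_cons_iff.1 hg with e | ⟨t, rfl, ht⟩
  · exact Or.inl e
  · exact Or.inr (by simpa using ht)

theorem prefix_enter {h w : List A} {g : List (AugAct A)}
    (hg : g <+: AugAct.start h :: AugAct.enter :: w.map AugAct.act) :
    g = [] ∨ g = [AugAct.start h] ∨
      ∃ w₁, w₁ <+: w ∧ g = AugAct.start h :: AugAct.enter :: w₁.map AugAct.act := by
  rcases List.prefix_cons_iff.1 hg with e | ⟨t, rfl, ht⟩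
  · exact Or.inl e
  · rcases List.prefix_cons_iff.1 ht with rfl | ⟨t', rfl, ht'⟩
    · exact Or.inr (Or.inl rfl)
    · obtain ⟨w₁, h1, rfl⟩ := List.prefix_map_iff.1 ht'
      exact Or.inr (Or.inr ⟨w₁, h1, rfl⟩)

theorem augInfo_enter (i : Player) (h w : List A) :
    G.augInfo i (AugAct.start h :: AugAct.enter :: w.map AugAct.act) = .sub (G.info i (h ++ w)) := by
  cases i <;> simp only [augInfo, AugAct.filterMap_act]

theorem augTurn_enter (h w : List A) :
    G.augTurn (AugAct.start h :: AugAct.enter :: w.map AugAct.act) = G.turn (h ++ w) := by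
  simp only [augTurn, AugAct.filterMap_act]

theorem augInfo_eq_sub {i : Player} {K : Info i} {x : List (AugAct A)} (hx : x ∈ augHist S)
    (e : G.augInfo i x = .sub K) : ∃ h ∈ S.top, ∃ w, h ++ w ∈ G.hist ∧
      x = AugAct.start h :: AugAct.enter :: w.map AugAct.act := by
  rcases mem_augHist.1 hx with rfl | ⟨h, hh, rfl⟩ | ⟨h, hh, rfl⟩ | h1
  · cases i <;> simp [augInfo] at e
  · cases i <;> simp [augInfo] at e
  · cases i <;> simp [augInfo] at e
  · exact h1

theorem augInfo_eq_root {J : Info .one} {x : List (AugAct A)} (hx : x ∈ augHist S)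
    (e : G.augInfo .one x = .root J) : ∃ h ∈ S.top, G.info .one h = J ∧ x = [AugAct.start h] := by
  rcases mem_augHist.1 hx with rfl | ⟨h, hh, rfl⟩ | ⟨h, hh, rfl⟩ | ⟨h, hh, w, hw, rfl⟩
  · simp [augInfo] at e
  · exact ⟨h, hh, by simpa [augInfo] using e, rfl⟩
  · simp [augInfo] at e
  · simp [augInfo] at e

theorem augTurn_eq_some {i : Player} {x : List (AugAct A)} (hx : x ∈ augHist S)
    (e : G.augTurn x = some i) : (∃ h ∈ S.top, x = [AugAct.start h] ∧ i = .one) ∨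
      ∃ h ∈ S.top, ∃ w, h ++ w ∈ G.hist ∧
        x = AugAct.start h :: AugAct.enter :: w.map AugAct.act := by
  rcases mem_augHist.1 hx with rfl | ⟨h, hh, rfl⟩ | ⟨h, hh, rfl⟩ | h1
  · simp [augTurn] at e
  · simp [augTurn] at e
    exact Or.inl ⟨h, hh, rfl, e.symm⟩
  · simp [augTurn] at e
  · exact Or.inr h1

theorem start_mem_augHist {h : List A} (hh : h ∈ S.top) : [AugAct.start h] ∈ augHist S :=
  mem_augHist.2 (Or.inr (Or.inl ⟨h, hh, rfl⟩))

theorem enter_mem_augHist {h : List A} (hh : h ∈ S.top) :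
    [AugAct.start h, AugAct.enter] ∈ augHist S :=
  mem_augHist.2 (Or.inr (Or.inr (Or.inr ⟨h, hh, [], by simpa using top_subset_hist hh, rfl⟩)))

end Nodes

variable (S : G.Subgame) (σ : Profile A Info) (hσ : G.IsStrategy .two (σ .two))
  (hpos : 0 < ∑ h ∈ S.top, G.reachOther σ .one h)

theorem perfectRecall_aug (hG : G.PerfectRecall) (altPay : Info .one → ℝ) :
    (aug S σ hσ hpos altPay).PerfectRecall := by
  intro i x hx y hy e g hg
  change x ∈ augHist S at hx
  change y ∈ augHist S at hy
  change G.augInfo i x = G.augInfo i y at e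
  change ∃ g', g' <+: y ∧ G.augInfo i g' = G.augInfo i g ∧
    ∀ a, G.augTurn g = some i → g ++ [a] <+: x → g' ++ [a] <+: y
  by_cases hgx : g = x
  · subst hgx
    refine ⟨y, List.prefix_refl _, e.symm, fun a _ h => ?_⟩
    have := h.length_le
    simp at this
  by_cases hg0 : g = []
  · subst hg0
    exact ⟨[], List.nil_prefix, rfl, fun a h => by simp [augTurn] at h⟩
  rcases mem_augHist.1 hx with rfl | ⟨h, hh, rfl⟩ | ⟨h, hh, rfl⟩ | ⟨h, hh, w, hw, rfl⟩
  · simp at hg; exact absurd hg hg0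
  · rcases prefix_start hg with h1 | h1
    · exact absurd h1 hg0
    · exact absurd h1 hgx
  · have hg1 : g = [AugAct.start h] := by
      rcases List.prefix_concat_iff.1 (show g <+: [AugAct.start h] ++ [AugAct.alt] from hg)
        with h1 | h1
      · exact absurd h1 hgx
      · exact (prefix_start h1).resolve_left hg0
    subst hg1
    cases i with
    | one =>
      rcases mem_augHist.1 hy with rfl | ⟨h', hh', rfl⟩ | ⟨h', hh', rfl⟩ | ⟨h', hh', w', hw', rfl⟩
      · simp [augInfo] at e
      · simp [augInfo] at e
      · refine ⟨[AugAct.start h'], by simp, ?_, ?_⟩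
        · simpa [augInfo] using e.symm
        · intro a _ ha
          simpa using ha
      · simp [augInfo] at e
    | two => exact ⟨[], List.nil_prefix, rfl, fun a h => by simp [augTurn] at h⟩
  · rw [augInfo_enter] at e
    obtain ⟨h', hh', w', hw', rfl⟩ := augInfo_eq_sub hy e.symm
    rw [augInfo_enter, AugInfo.sub.injEq] at e
    rcases prefix_enter hg with h1 | rfl | ⟨w₁, hw₁, rfl⟩
    · exact absurd h1 hg0
    · refine ⟨[AugAct.start h'], by simp, ?_, ?_⟩
      · cases i with
        | one => simpa [augInfo] using (info_top_eq hG hh hh' hw hw' e).symm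
        | two => rfl
      · intro a _ ha
        simpa using ha
    · obtain ⟨g', hg', e', H⟩ := hG i _ hw _ hw' e (h ++ w₁)
        ((List.prefix_append_right_inj h).2 hw₁)
      have hg'S := S.info_mem i (h ++ w₁) (append_mem_nodes hh (G.mem_hist_of_prefix
        ((List.prefix_append_right_inj h).2 hw₁) hw)) g' (G.mem_hist_of_prefix hg' hw') e'
      obtain ⟨w₂, rfl⟩ := top_prefix_of_mem hh' hg'S (List.prefix_append h' w') hg'
      rw [List.prefix_append_right_inj] at hg'
      refine ⟨AugAct.start h' :: AugAct.enter :: w₂.map AugAct.act, ?_, ?_, ?_⟩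
      · simpa using hg'.map AugAct.act
      · rw [augInfo_enter, augInfo_enter, e']
      · intro a ht ha
        rw [augTurn_enter] at ht
        simp only [List.cons_append, List.prefix_cons_inj] at ha ⊢
        obtain ⟨w₃, hw₃, e₃⟩ := List.prefix_map_iff.1 ha
        rcases List.eq_nil_or_concat w₃ with rfl | ⟨w₄, b, rfl⟩
        · simp at e₃
        · rw [List.concat_eq_append, List.map_append, List.map_singleton] at e₃
          obtain ⟨e₄, e₅⟩ := List.append_inj' e₃ rfl
          have e₆ := congrArg (List.filterMap AugAct.orig?) e₄
          rw [AugAct.filterMap_act, AugAct.filterMap_act] at e₆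
          subst e₆
          rw [e₅]
          have h3 := H b ht (by
            rw [List.append_assoc, List.prefix_append_right_inj]
            simpa using hw₃)
          rw [List.append_assoc, List.prefix_append_right_inj] at h3
          simpa using h3.map AugAct.act

/-! ### Values in the augmented subgame -/

section Values

variable {S σ hσ hpos} {altPay : Info .one → ℝ}
  {τ : Profile (AugAct A) (fun i => AugInfo (Info i))}

/-- The probability that chance selects `h` at the start of the augmented subgame. -/
abbrev topProb (S : G.Subgame) (σ : Profile A Info) (h : List A) : ℝ :=
  augChance S σ [] (.start h)

theorem topProb_nonneg (hσ : G.IsStrategy .two (σ .two))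
    (hpos : 0 < ∑ h ∈ S.top, G.reachOther σ .one h) {h : List A} (hh : h ∈ S.top) :
    0 ≤ topProb S σ h :=
  div_nonneg (reachOther_one_nonneg S σ hσ hh) hpos.le

variable (S σ hσ hpos) in
/-- The expected value for player one of entering the subgame at `h`; alternative payoffs are
irrelevant for it and are set to zero. -/
def enterValue (s₁ : Strategy (AugAct A) (AugInfo (Info .one)))
    (s₂ : Strategy (AugAct A) (AugInfo (Info .two))) (h : List A) : ℝ :=
  (aug S σ hσ hpos fun _ => 0).value (mkProfile (Info := fun i => AugInfo (Info i)) s₁ s₂) .one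
    [.start h, .enter]

theorem aug_acts_start {h : List A} (hh : h ∈ S.top) :
    (aug S σ hσ hpos altPay).acts [.start h] = {.enter, .alt} :=
  actsIn_augHist_start S hh

/-- The value of entering the subgame depends neither on the alternative payoffs nor on the
strategies outside the subgame. -/
theorem aug_value_enter {s₁ : Strategy (AugAct A) (AugInfo (Info .one))}
    {s₂ : Strategy (AugAct A) (AugInfo (Info .two))}
    (h1 : ∀ K, τ .one (.sub K) = s₁ (.sub K)) (h2 : ∀ K, τ .two (.sub K) = s₂ (.sub K))
    (h : List A) :
    (aug S σ hσ hpos altPay).value τ .one [.start h, .enter] =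
      enterValue S σ hσ hpos s₁ s₂ h := by
  unfold enterValue value
  refine Finset.sum_congr rfl fun z hz => ?_
  by_cases e : [AugAct.start h, AugAct.enter] <+: z
  · have h3 : ∀ j g, [AugAct.start h, AugAct.enter] <+: g → g ∈ augHist S →
        ∃ K, G.augInfo j g = .sub K := by
      rintro j _ ⟨w, rfl⟩ _
      cases j <;> exact ⟨_, rfl⟩
    congr 1
    · change (aug S σ hσ hpos fun _ => 0).reachFrom τ _ z = _
      refine reachFrom_congr fun g a hg ha j _ => ?_
      obtain ⟨K, hK⟩ := h3 j g hg (mem_hist_of_prefix (aug S σ hσ hpos fun _ => 0)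
        ((List.prefix_append g [a]).trans ha) (mem_terminals.1 hz).1)
      change τ j (G.augInfo j g) a = mkProfile (Info := fun i => AugInfo (Info i)) s₁ s₂ j
        (G.augInfo j g) a
      rw [hK]
      cases j
      · exact congrFun (h1 K) a
      · exact congrFun (h2 K) a
    · obtain ⟨w, rfl⟩ := e
      rfl
  · rw [reachFrom_of_not_prefix _ _ e, reachFrom_of_not_prefix _ _ e, zero_mul, zero_mul]

theorem aug_value_enter_eq (τ : Profile (AugAct A) (fun i => AugInfo (Info i))) (h : List A) :
    (aug S σ hσ hpos altPay).value τ .one [.start h, .enter] =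
      enterValue S σ hσ hpos (τ .one) (τ .two) h :=
  aug_value_enter (fun _ => rfl) (fun _ => rfl) h

theorem aug_value_start {s₁ : Strategy (AugAct A) (AugInfo (Info .one))}
    {s₂ : Strategy (AugAct A) (AugInfo (Info .two))} {h : List A} (hh : h ∈ S.top) :
    (aug S σ hσ hpos altPay).value (mkProfile (Info := fun i => AugInfo (Info i)) s₁ s₂) .one
      [.start h] = s₁ (.root (G.info .one h)) .enter * enterValue S σ hσ hpos s₁ s₂ h +
        s₁ (.root (G.info .one h)) .alt * altPay (G.info .one h) := by
  rw [value_eq_sum_acts _ _ _ (by rw [aug_acts_start hh]; simp), aug_acts_start hh,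
    Finset.sum_pair (by simp)]
  congr 1
  · congr 1
    exact aug_value_enter_eq _ h
  · congr 1
    exact value_of_acts_eq_empty _ _ _ (mem_augHist.2 (Or.inr (Or.inr (Or.inl ⟨h, hh, rfl⟩))))
      (actsIn_augHist_alt S h)

theorem aug_reachFrom_enter (h : List A) :
    (aug S σ hσ hpos altPay).reachFrom τ [] [.start h, .enter] =
      topProb S σ h * τ .one (.root (G.info .one h)) .enter := by
  have h1 := reachFrom_append (aug S σ hσ hpos altPay) τ [] [.start h, .enter]
  rw [List.nil_append] at h1
  rw [h1]
  simp only [pathProb, mul_one]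
  rfl

theorem aug_reachOwn_start (h : List A) :
    (aug S σ hσ hpos altPay).reachOwn τ .one [.start h] = 1 := by
  simp [reachOwn, pathProb, aug, augTurn]

theorem aug_reachOther_start (h : List A) :
    (aug S σ hσ hpos altPay).reachOther τ .one [.start h] = topProb S σ h := by
  simp [reachOther, pathProb, aug, augTurn, stepProb]

theorem aug_isStrategy_root {s₁ : Strategy (AugAct A) (AugInfo (Info .one))}
    (hs : (aug S σ hσ hpos altPay).IsStrategy .one s₁) {h : List A} (hh : h ∈ S.top) :
    0 ≤ s₁ (.root (G.info .one h)) .enter ∧ 0 ≤ s₁ (.root (G.info .one h)) .alt ∧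
      s₁ (.root (G.info .one h)) .enter + s₁ (.root (G.info .one h)) .alt = 1 := by
  obtain ⟨h1, -, h3⟩ := hs [.start h] (start_mem_augHist hh) rfl
    (by rw [aug_acts_start hh]; simp)
  rw [aug_acts_start hh, Finset.sum_pair (by simp)] at h3
  exact ⟨h1 _, h1 _, h3⟩

/-- The set of nodes of the augmented subgame at which player one enters the subgame, from
earliest-reachable nodes in `B`. -/
def enterNodes (B : Finset (List A)) : Finset (List (AugAct A)) :=
  B.image fun h => [.start h, .enter]

/-- The nodes at which the subgame is entered, from earliest-reachable nodes in `B`, form a cut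
for player `i` if no information set of `i` in the subgame leads out of `B`. -/
theorem isCut_enterNodes {i : Player} {B : Finset (List A)} (hB : B ⊆ S.top)
    (hBi : ∀ h ∈ B, ∀ h' ∈ S.top, ∀ w w', h ++ w ∈ G.hist → h' ++ w' ∈ G.hist →
      G.info i (h ++ w) = G.info i (h' ++ w') → h' ∈ B) :
    (aug S σ hσ hpos altPay).IsCut i (enterNodes B) where
  subset := by
    intro d hd
    obtain ⟨h, hh, rfl⟩ := Finset.mem_image.1 hd
    exact enter_mem_augHist (hB hh)
  eq_of_prefix := by
    intro d hd d' hd' g hdg hdg'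
    obtain ⟨h, hh, rfl⟩ := Finset.mem_image.1 hd
    obtain ⟨h', hh', rfl⟩ := Finset.mem_image.1 hd'
    obtain ⟨w, rfl⟩ := hdg
    simp only [List.cons_append, List.nil_append, List.cons_prefix_cons, AugAct.start.injEq] at hdg'
    rw [hdg'.1]
  info_mem := by
    intro g hg g' hg' e
    obtain ⟨hm, ht, -, d, hd, hdg⟩ := mem_decisionsBelow.1 hg
    obtain ⟨h, hh, rfl⟩ := Finset.mem_image.1 hd
    change G.augInfo i g' = G.augInfo i g at e
    rcases augTurn_eq_some hm ht with ⟨h₁, _, rfl, _⟩ | ⟨h₁, hh₁, w, hw, rfl⟩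
    · have := hdg.length_le
      simp at this
    · rw [augInfo_enter] at e
      obtain ⟨h', hh', w', hw', rfl⟩ := augInfo_eq_sub hg' e
      rw [augInfo_enter, AugInfo.sub.injEq] at e
      simp only [List.cons_prefix_cons, AugAct.start.injEq] at hdg
      obtain ⟨rfl, -⟩ := hdg
      exact ⟨_, Finset.mem_image_of_mem _ (hBi h hh h' hh' w w' hw hw' e.symm), by simp⟩

theorem sum_enterNodes (B : Finset (List A)) (F : List (AugAct A) → ℝ) :
    ∑ d ∈ enterNodes B, F d = ∑ h ∈ B, F [.start h, .enter] :=
  Finset.sum_image fun a _ b _ e => by simpa using e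

end Values

/-! ### The modified root decisions -/

section Patch

variable {Ω : Type w} [MeasurableSpace Ω] (P : Measure Ω)
  (X : Info .one → Ω → ℝ)

theorem rootPatch_sub (G' : Game (AugAct A) (fun i => AugInfo (Info i)))
    (τ : Profile (AugAct A) (fun i => AugInfo (Info i))) (i : Player) (K : Info i) :
    rootPatch G' P X τ i (.sub K) = τ i (.sub K) := by
  cases i <;> rfl

variable {S σ hσ hpos} {altPay : Info .one → ℝ}

theorem isStrategy_rootPatch [IsProbabilityMeasure P]
    (τ : Profile (AugAct A) (fun i => AugInfo (Info i)))
    (hτ : ∀ j, (aug S σ hσ hpos altPay).IsStrategy j (τ j)) (j : Player) :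
    (aug S σ hσ hpos altPay).IsStrategy j (rootPatch (aug S σ hσ hpos altPay) P X τ j) := by
  intro x hx ht ha
  rcases augTurn_eq_some hx ht with ⟨h, hh, rfl, rfl⟩ | ⟨h, hh, w, hw, rfl⟩
  · rw [aug_acts_start hh]
    change (∀ a, 0 ≤ rootPatch _ P X τ .one (.root (G.info .one h)) a) ∧
      (∀ a, a ∉ _ → rootPatch _ P X τ .one (.root (G.info .one h)) a = 0) ∧
      ∑ a ∈ _, rootPatch _ P X τ .one (.root (G.info .one h)) a = 1
    refine ⟨fun a => ?_, fun a h1 => ?_, ?_⟩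
    · cases a with
      | enter => exact measureReal_nonneg
      | alt => exact sub_nonneg.2 measureReal_le_one
      | start _ => exact le_rfl
      | act _ => exact le_rfl
    · cases a with
      | enter => simp at h1
      | alt => simp at h1
      | start _ => rfl
      | act _ => rfl
    · rw [Finset.sum_pair (by simp)]
      exact add_sub_cancel _ _
  · have h1 : (aug S σ hσ hpos altPay).info j
        (AugAct.start h :: AugAct.enter :: w.map AugAct.act) = .sub (G.info j (h ++ w)) :=
      augInfo_enter j h w
    have h2 := hτ j _ hx ht ha
    rw [h1] at h2 ⊢
    rwa [rootPatch_sub]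

end Patch

end Game

namespace Game

variable {A : Type u} {Info : Player → Type v} {G : Game A Info}

/-! ### Regret in the augmented subgame -/

section GadgetCFR

variable (S : G.Subgame) (σ : Profile A Info) (hσ : G.IsStrategy .two (σ .two))
  (hpos : 0 < ∑ h ∈ S.top, G.reachOther σ .one h) (altPay : Info .one → ℝ)
  {Ω : Type w} [MeasurableSpace Ω] (P : Measure Ω) (X : Info .one → Ω → ℝ)

/-- The profile played on the iteration `t` of the modified CFR in the augmented subgame. -/
def gadgetProfile (t : ℕ) : Profile (AugAct A) (fun i => AugInfo (Info i)) :=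
  (aug S σ hσ hpos altPay).cfrProfile (rootPatch (aug S σ hσ hpos altPay) P X) t

/-- The expected value of entering the subgame, on the iteration `t`, for player one at the root
information set that belongs to `J`. -/
def gadgetThreshold (t : ℕ) (J : Info .one) : ℝ :=
  (aug S σ hσ hpos altPay).infosetActValue
    ((aug S σ hσ hpos altPay).regretMatching
      ((aug S σ hσ hpos altPay).cfrRegret (rootPatch (aug S σ hσ hpos altPay) P X) t))
    .one (.root J) .enter

/-- The CFR average strategy of player one in the augmented subgame. -/
def gadgetCFROne (T : ℕ) : Strategy (AugAct A) (AugInfo (Info .one)) :=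
  (aug S σ hσ hpos altPay).averageStrategy (gadgetProfile S σ hσ hpos altPay P X) T .one

/-- The value of entering the subgame at `h` on the iteration `t`. -/
def gadgetValue (t : ℕ) (h : List A) : ℝ :=
  enterValue S σ hσ hpos (gadgetProfile S σ hσ hpos altPay P X t .one)
    (gadgetProfile S σ hσ hpos altPay P X t .two) h

theorem gadgetProfile_root_enter (t : ℕ) (J : Info .one) :
    gadgetProfile S σ hσ hpos altPay P X t .one (.root J) .enter =
      P.real {ω | X J ω ≤ gadgetThreshold S σ hσ hpos altPay P X t J} :=
  rfl

theorem isStrategy_gadgetProfile [IsProbabilityMeasure P] (t : ℕ) (i : Player) :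
    (aug S σ hσ hpos altPay).IsStrategy i (gadgetProfile S σ hσ hpos altPay P X t i) :=
  isStrategy_cfrProfile (isStrategy_rootPatch P X) t i

theorem sum_infoset_root (J : Info .one) (F : List (AugAct A) → ℝ) :
    ∑ x ∈ (aug S σ hσ hpos altPay).infoset .one (.root J), F x =
      ∑ h ∈ S.top with G.info .one h = J, F [.start h] := by
  have h1 : (aug S σ hσ hpos altPay).infoset .one (.root J) =
      (S.top.filter fun h => G.info .one h = J).image fun h => [AugAct.start h] := by
    ext x
    rw [mem_infoset, Finset.mem_image]
    constructor
    · rintro ⟨hx, e⟩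
      obtain ⟨h, hh, e1, rfl⟩ := augInfo_eq_root hx e
      exact ⟨h, Finset.mem_filter.2 ⟨hh, e1⟩, rfl⟩
    · rintro ⟨h, hh, rfl⟩
      obtain ⟨hh', rfl⟩ := Finset.mem_filter.1 hh
      exact ⟨start_mem_augHist hh', rfl⟩
  rw [h1, Finset.sum_image fun a _ b _ e => by simpa using e]

/-- The threshold is the conditional mean of the values of entering. -/
theorem sum_topProb_mul_gadgetValue (t : ℕ) (J : Info .one) :
    ∑ h ∈ S.top with G.info .one h = J, topProb S σ h * gadgetValue S σ hσ hpos altPay P X t h =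
      (∑ h ∈ S.top with G.info .one h = J, topProb S σ h) *
        gadgetThreshold S σ hσ hpos altPay P X t J := by
  unfold gadgetThreshold infosetActValue
  rw [sum_infoset_root, sum_infoset_root]
  simp only [aug_reachOther_start]
  have h1 : ∀ h, (aug S σ hσ hpos altPay).value ((aug S σ hσ hpos altPay).regretMatching
      ((aug S σ hσ hpos altPay).cfrRegret (rootPatch (aug S σ hσ hpos altPay) P X) t)) .one
      ([.start h] ++ [.enter]) = gadgetValue S σ hσ hpos altPay P X t h := fun h =>
    aug_value_enter (fun K => (rootPatch_sub P X _ _ _ K).symm)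
      (fun _ => rfl) h
  simp only [h1]
  by_cases h0 : ∑ h ∈ S.top with G.info .one h = J, topProb S σ h = 0
  -- If the information set has probability zero, the threshold is a quotient by zero, but all the
  -- weights vanish as well.
  · rw [h0, zero_mul]
    rw [Finset.sum_eq_zero_iff_of_nonneg fun h hh =>
      topProb_nonneg hσ hpos (Finset.mem_filter.1 hh).1] at h0
    exact Finset.sum_eq_zero fun h hh => by rw [h0 h hh, zero_mul]
  · rw [mul_div_cancel₀ _ h0]

variable {S σ hσ hpos altPay P X}

theorem rootPatch_decisionsBelow_enterNodes {i : Player} {B : Finset (List A)}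
    {g : List (AugAct A)} (hg : g ∈ (aug S σ hσ hpos altPay).decisionsBelow i (enterNodes B))
    (τ : Profile (AugAct A) (fun i => AugInfo (Info i))) :
    rootPatch (aug S σ hσ hpos altPay) P X τ i ((aug S σ hσ hpos altPay).info i g) =
      τ i ((aug S σ hσ hpos altPay).info i g) := by
  obtain ⟨hm, ht, -, d, hd, hdg⟩ := mem_decisionsBelow.1 hg
  obtain ⟨h, hh, rfl⟩ := Finset.mem_image.1 hd
  rcases augTurn_eq_some hm ht with ⟨h₁, _, rfl, _⟩ | ⟨h₁, hh₁, w, hw, rfl⟩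
  · have := hdg.length_le
    simp at this
  · rw [show (aug S σ hσ hpos altPay).info i
      (AugAct.start h₁ :: AugAct.enter :: w.map AugAct.act) = .sub (G.info i (h₁ ++ w)) from
      augInfo_enter i h₁ w, rootPatch_sub]

/-- Player one has not acted before the root, so that the average there is the plain mean. -/
theorem gadgetCFROne_root_enter (hG : G.PerfectRecall) {T : ℕ} (hT : 0 < T) {h : List A}
    (hh : h ∈ S.top) :
    T * gadgetCFROne S σ hσ hpos altPay P X T (.root (G.info .one h)) .enter =
      ∑ t ∈ Finset.range T,
        gadgetProfile S σ hσ hpos altPay P X t .one (.root (G.info .one h)) .enter := by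
  have h1 : ∀ τ, (aug S σ hσ hpos altPay).infosetReach τ .one (.root (G.info .one h)) = 1 :=
    fun τ => ((perfectRecall_aug S σ hσ hpos hG altPay).infosetReach_eq τ
      (start_mem_augHist hh)).trans (aug_reachOwn_start h)
  have hT' : (T : ℝ) ≠ 0 := by exact_mod_cast hT.ne'
  unfold gadgetCFROne averageStrategy
  simp only [h1, one_mul, Finset.sum_const, Finset.card_range, nsmul_eq_mul, mul_one]
  rw [if_neg hT', mul_div_cancel₀ _ hT']

variable [IsProbabilityMeasure P]

/-- The regret of player one below a root information set is sublinear, whatever the probability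
of entering from there. -/
theorem exists_gadget_regret_one_le (hG : G.PerfectRecall) (J : Info .one) :
    ∃ C : ℝ, ∀ (T : ℕ) (s₁ : Strategy (AugAct A) (AugInfo (Info .one))),
      (aug S σ hσ hpos altPay).IsStrategy .one s₁ →
      ∑ t ∈ Finset.range T, ∑ h ∈ S.top with G.info .one h = J,
        topProb S σ h * s₁ (.root J) .enter *
          (enterValue S σ hσ hpos s₁ (gadgetProfile S σ hσ hpos altPay P X t .two) h -
            gadgetValue S σ hσ hpos altPay P X t h) ≤ C * √T := by
  obtain ⟨C, hC⟩ := exists_cfr_regret_le (perfectRecall_aug S σ hσ hpos hG altPay)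
    (isStrategy_rootPatch P X) (isCut_enterNodes (i := .one)
      (B := S.top.filter fun h => G.info .one h = J) (Finset.filter_subset _ _)
      (fun h hh h' hh' w w' hw hw' e => Finset.mem_filter.2 ⟨hh', by
        rw [← (Finset.mem_filter.1 hh).2]
        exact (info_top_eq hG (Finset.mem_filter.1 hh).1 hh' hw hw' e).symm⟩))
    fun g hg => rootPatch_decisionsBelow_enterNodes hg
  refine ⟨C, fun T s₁ hs => ?_⟩
  refine le_trans (le_of_eq ?_) (hC T (fun t => mkProfile (Info := fun i => AugInfo (Info i)) s₁
    (gadgetProfile S σ hσ hpos altPay P X t .two)) hs (fun _ => by simp only [mkProfile_one]) ?_)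
  · refine Finset.sum_congr rfl fun t _ => ?_
    rw [sum_enterNodes]
    refine Finset.sum_congr rfl fun h hh => ?_
    rw [aug_reachFrom_enter, (Finset.mem_filter.1 hh).2, aug_value_enter_eq, aug_value_enter_eq]
    rfl
  · intro t j hj
    cases j with
    | one => exact absurd rfl hj
    | two => rfl

/-- The regret of player two, who acts only after player one has entered the subgame. -/
theorem exists_gadget_regret_two_le (hG : G.PerfectRecall) :
    ∃ C : ℝ, ∀ (T : ℕ) (s₂ : Strategy (AugAct A) (AugInfo (Info .two))),
      (aug S σ hσ hpos altPay).IsStrategy .two s₂ →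
      ∑ t ∈ Finset.range T, ∑ h ∈ S.top,
        topProb S σ h * gadgetProfile S σ hσ hpos altPay P X t .one (.root (G.info .one h)) .enter *
          (gadgetValue S σ hσ hpos altPay P X t h -
            enterValue S σ hσ hpos (gadgetProfile S σ hσ hpos altPay P X t .one) s₂ h)
            ≤ C * √T := by
  obtain ⟨C, hC⟩ := exists_cfr_regret_le (perfectRecall_aug S σ hσ hpos hG altPay)
    (isStrategy_rootPatch P X) (isCut_enterNodes (i := .two) (B := S.top) subset_rfl
      (fun _ _ _ hh' _ _ _ _ _ => hh')) fun g hg => rootPatch_decisionsBelow_enterNodes hg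
  refine ⟨C, fun T s₂ hs => ?_⟩
  refine le_trans (le_of_eq ?_) (hC T (fun t => mkProfile (Info := fun i => AugInfo (Info i))
    (gadgetProfile S σ hσ hpos altPay P X t .one) s₂) hs (fun _ => by simp only [mkProfile_two]) ?_)
  · refine Finset.sum_congr rfl fun t _ => ?_
    rw [sum_enterNodes]
    refine Finset.sum_congr rfl fun h hh => ?_
    rw [aug_reachFrom_enter, value_two, value_two, neg_sub_neg, aug_value_enter_eq,
      aug_value_enter_eq]
    rfl
  · intro t j hj
    cases j with
    | one => rfl
    | two => exact absurd rfl hj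

theorem enterValue_gadgetCFR (hG : G.PerfectRecall) (T : ℕ)
    (s₁ : Strategy (AugAct A) (AugInfo (Info .one))) (h : List A) :
    T * (topProb S σ h * s₁ (.root (G.info .one h)) .enter *
        enterValue S σ hσ hpos s₁ (gadgetCFR S σ hσ hpos altPay P X T) h) =
      ∑ t ∈ Finset.range T, topProb S σ h * s₁ (.root (G.info .one h)) .enter *
        enterValue S σ hσ hpos s₁ (gadgetProfile S σ hσ hpos altPay P X t .two) h := by
  have h1 := reach_mul_value_averageStrategy (i := .two)
    (perfectRecall_aug S σ hσ hpos hG altPay)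
    (τ := gadgetProfile S σ hσ hpos altPay P X) (fun t => isStrategy_gadgetProfile _ _ _ _ _ _ _ t _)
    (T := T) (ρ := mkProfile (Info := fun i => AugInfo (Info i)) s₁
      (gadgetCFR S σ hσ hpos altPay P X T))
    (ρ' := fun t => mkProfile (Info := fun i => AugInfo (Info i)) s₁
      (gadgetProfile S σ hσ hpos altPay P X t .two)) rfl (fun _ => rfl)
    (fun t j hj => by
      cases j with
      | one => rfl
      | two => exact absurd rfl hj) .one [.start h, .enter]
  simpa only [aug_reachFrom_enter, aug_value_enter_eq, mkProfile_one, mkProfile_two] using h1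

theorem enterValue_gadgetCFROne (hG : G.PerfectRecall) (T : ℕ)
    (s₂ : Strategy (AugAct A) (AugInfo (Info .two))) (h : List A) :
    T * (topProb S σ h *
        gadgetCFROne S σ hσ hpos altPay P X T (.root (G.info .one h)) .enter *
        enterValue S σ hσ hpos (gadgetCFROne S σ hσ hpos altPay P X T) s₂ h) =
      ∑ t ∈ Finset.range T, topProb S σ h *
        gadgetProfile S σ hσ hpos altPay P X t .one (.root (G.info .one h)) .enter *
        enterValue S σ hσ hpos (gadgetProfile S σ hσ hpos altPay P X t .one) s₂ h := by
  have h1 := reach_mul_value_averageStrategy (i := .one)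
    (perfectRecall_aug S σ hσ hpos hG altPay)
    (τ := gadgetProfile S σ hσ hpos altPay P X) (fun t => isStrategy_gadgetProfile _ _ _ _ _ _ _ t _)
    (T := T) (ρ := mkProfile (Info := fun i => AugInfo (Info i))
      (gadgetCFROne S σ hσ hpos altPay P X T) s₂)
    (ρ' := fun t => mkProfile (Info := fun i => AugInfo (Info i))
      (gadgetProfile S σ hσ hpos altPay P X t .one) s₂) rfl (fun _ => rfl)
    (fun t j hj => by
      cases j with
      | two => rfl
      | one => exact absurd rfl hj) .one [.start h, .enter]
  simpa only [aug_reachFrom_enter, aug_value_enter_eq, mkProfile_one, mkProfile_two] using h1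

theorem gadgetCFROne_mem_Icc (T : ℕ) (K : AugInfo (Info .one)) (a : AugAct A) :
    gadgetCFROne S σ hσ hpos altPay P X T K a ∈ Set.Icc (0 : ℝ) 1 := by
  refine averageStrategy_mem_Icc (fun t => isStrategy_gadgetProfile _ _ _ _ _ _ _ t _)
    (fun t K a => ?_) T K a
  have h1 := fun R K a => regretMatching_mem_Icc (G := aug S σ hσ hpos altPay) (i := .one) R K a
  unfold gadgetProfile cfrProfile
  cases K with
  | root J =>
    cases a with
    | enter => exact ⟨measureReal_nonneg, measureReal_le_one⟩
    | alt => exact ⟨sub_nonneg.2 measureReal_le_one, sub_le_self _ measureReal_nonneg⟩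
    | start _ => exact ⟨le_rfl, zero_le_one⟩
    | act _ => exact ⟨le_rfl, zero_le_one⟩
  | pre => exact h1 _ _ _
  | out J => exact h1 _ _ _
  | sub J => exact h1 _ _ _

end GadgetCFR

end Game

/-! ### Threshold rules -/

section NeymanPearson

variable {Ω : Type w} [MeasurableSpace Ω] {P : Measure Ω} [IsProbabilityMeasure P] {X : Ω → ℝ}

theorem integrable_max_const_sub (hX : Integrable X P) (θ : ℝ) :
    Integrable (fun ω => max (θ - X ω) 0) P :=
  ((integrable_const θ).sub hX).pos_part

/-- A level `θ` of mass at most `q` strictly below it and at least `q` weakly below it. -/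
theorem exists_quantile (ν : Measure ℝ) [IsProbabilityMeasure ν] {q : ℝ} (h0 : 0 < q)
    (h1 : q < 1) : ∃ θ : ℝ, ν.real (Set.Iio θ) ≤ q ∧ q ≤ ν.real (Set.Iic θ) := by
  set F := ProbabilityTheory.cdf ν
  set s : Set ℝ := {x | q ≤ F x}
  have hne : s.Nonempty := by
    obtain ⟨x, hx⟩ := ((ProbabilityTheory.tendsto_cdf_atTop ν).eventually_const_lt h1).exists
    exact ⟨x, hx.le⟩
  have hbdd : BddBelow s := by
    obtain ⟨x, hx⟩ := ((ProbabilityTheory.tendsto_cdf_atBot ν).eventually_lt_const h0).exists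
    exact ⟨x, fun y hy => not_lt.1 fun hyx =>
      (hx.trans_le hy).not_ge (ProbabilityTheory.monotone_cdf ν hyx.le)⟩
  refine ⟨sInf s, ?_, ?_⟩
  · have h2 : Tendsto F (𝓝[<] sInf s) (𝓝 (Function.leftLim F (sInf s))) :=
      F.mono.tendsto_leftLim _
    have h3 : Function.leftLim F (sInf s) ≤ q := by
      refine le_of_tendsto h2 ?_
      filter_upwards [self_mem_nhdsWithin] with x hx
      exact (not_le.1 fun h => notMem_of_lt_csInf hx hbdd h).le
    have h4 := F.measure_Iio (ProbabilityTheory.tendsto_cdf_atBot ν) (sInf s)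
    rw [ProbabilityTheory.measure_cdf] at h4
    rw [measureReal_def, h4, sub_zero, ENNReal.toReal_ofReal_eq_iff.2]
    · exact h3
    · exact ge_of_tendsto h2 (Eventually.of_forall fun x => ProbabilityTheory.cdf_nonneg ν x)
  · rw [← ProbabilityTheory.cdf_eq_real]
    refine ge_of_tendsto ((F.right_continuous (sInf s)).tendsto.mono_left
      (nhdsWithin_mono _ Set.Ioi_subset_Ici_self)) ?_
    filter_upwards [self_mem_nhdsWithin] with x hx
    obtain ⟨y, hy, hyx⟩ := exists_lt_of_csInf_lt hne hx
    exact le_trans hy (F.mono hyx.le)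

/-- A Neyman–Pearson lemma: among the rules `p` that accept the outcome of `X` with total
probability `q`, the mean of `p X * X` is smallest for a threshold rule, for which it is the
supremum of `θ * q - 𝔼 (θ - X)⁺` over all levels `θ`. -/
theorem exists_threshold_rule (hX : Integrable X P) {q m : ℝ} (hq : q ∈ Set.Icc (0 : ℝ) 1)
    (hm : ∀ θ : ℝ, θ * q - ∫ ω, max (θ - X ω) 0 ∂P ≤ m) :
    ∃ p : ℝ → ℝ, Measurable p ∧ (∀ x, p x ∈ Set.Icc (0 : ℝ) 1) ∧ ∫ ω, p (X ω) ∂P = q ∧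
      ∫ ω, p (X ω) * X ω ∂P ≤ m := by
  rcases hq.1.eq_or_lt with rfl | h0
  · refine ⟨fun _ => 0, measurable_const, fun _ => by simp, by simp, ?_⟩
    simp only [zero_mul, integral_zero]
    -- The bound on `m` comes from the levels `-n`.
    have h1 : Tendsto (fun n : ℕ => ∫ ω, max (-(n : ℝ) - X ω) 0 ∂P) atTop (𝓝 (∫ _, (0 : ℝ) ∂P)) := by
      refine tendsto_integral_of_dominated_convergence (fun ω => |X ω|)
        (fun n => (integrable_max_const_sub hX _).aestronglyMeasurable) hX.abs
        (fun n => Eventually.of_forall fun ω => ?_) (Eventually.of_forall fun ω => ?_)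
      · rw [Real.norm_eq_abs, abs_of_nonneg (le_max_right _ _)]
        have h2 : (0 : ℝ) ≤ n := Nat.cast_nonneg n
        exact max_le (by linarith [neg_le_abs (X ω)]) (abs_nonneg _)
      · refine tendsto_const_nhds.congr' ?_
        filter_upwards [eventually_ge_atTop ⌈-X ω⌉₊] with n hn
        rw [max_eq_right]
        linarith [Nat.ceil_le.1 hn]
    rw [integral_zero] at h1
    have h2 := h1.neg
    rw [neg_zero] at h2
    refine le_of_tendsto h2 (Eventually.of_forall fun n => ?_)
    simpa using hm (-(n : ℝ))
  rcases hq.2.eq_or_lt with rfl | h1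
  · refine ⟨fun _ => 1, measurable_const, fun _ => by simp, by simp, ?_⟩
    simp only [one_mul]
    -- The bound on `m` comes from the levels `n`, as `n - (n - x)⁺` is the minimum of `x` and `n`.
    have h1 : Tendsto (fun n : ℕ => ∫ ω, ((n : ℝ) - max ((n : ℝ) - X ω) 0) ∂P) atTop
        (𝓝 (∫ ω, X ω ∂P)) := by
      refine tendsto_integral_of_dominated_convergence (fun ω => |X ω|)
        (fun n => ((integrable_const _).sub (integrable_max_const_sub hX _)).aestronglyMeasurable)
        hX.abs (fun n => Eventually.of_forall fun ω => ?_) (Eventually.of_forall fun ω => ?_)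
      · have h2 : (0 : ℝ) ≤ n := Nat.cast_nonneg n
        rw [Real.norm_eq_abs, abs_le]
        constructor
        · have := max_le (a := (n : ℝ) - X ω) (b := 0) (c := n + |X ω|)
            (by linarith [neg_le_abs (X ω)]) (by positivity)
          linarith
        · linarith [le_max_left ((n : ℝ) - X ω) 0, le_abs_self (X ω)]
      · refine tendsto_const_nhds.congr' ?_
        filter_upwards [eventually_ge_atTop ⌈X ω⌉₊] with n hn
        rw [max_eq_left]
        · ring
        · linarith [Nat.ceil_le.1 hn]
    refine le_of_tendsto h1 (Eventually.of_forall fun n => ?_)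
    rw [integral_sub (integrable_const _) (integrable_max_const_sub hX _)]
    simpa using hm (n : ℝ)
  have : IsProbabilityMeasure (P.map X) := Measure.isProbabilityMeasure_map hX.aemeasurable
  obtain ⟨θ, ha, hb⟩ := exists_quantile (P.map X) h0 h1
  set a := (P.map X).real (Set.Iio θ)
  set b := (P.map X).real {θ}
  have hab : (P.map X).real (Set.Iic θ) = a + b := by
    rw [← Set.Iio_union_right, measureReal_union (by simp) (measurableSet_singleton θ)]
  rw [hab] at hb
  obtain ⟨l, hl, hlq⟩ : ∃ l ∈ Set.Icc (0 : ℝ) 1, a + l * b = q := by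
    have hb0 : 0 ≤ b := measureReal_nonneg
    rcases hb0.eq_or_lt with e | e
    · exact ⟨0, by simp, by linarith⟩
    · exact ⟨(q - a) / b, ⟨div_nonneg (by linarith) hb0, (div_le_one e).2 (by linarith)⟩, by
        field_simp; ring⟩
  set p : ℝ → ℝ := fun x => (Set.Iio θ).indicator 1 x + l * Set.indicator {θ} 1 x with hp
  have hpm : Measurable p := (measurable_one.indicator measurableSet_Iio).add
    ((measurable_one.indicator (measurableSet_singleton θ)).const_mul l)
  have hp01 : ∀ x, p x ∈ Set.Icc (0 : ℝ) 1 := by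
    intro x
    rcases lt_trichotomy x θ with h | h | h
    · simp [hp, h, h.ne]
    · subst h; simpa [hp] using hl
    · simp [hp, h.le, h.ne']
  -- Pointwise optimality: `p x * (x - θ)` is the least possible value of an acceptance rule.
  have hpθ : ∀ x, p x * x = θ * p x - max (θ - x) 0 := by
    intro x
    rcases lt_trichotomy x θ with h | h | h
    · simp [hp, h, h.ne, h.le]
    · subst h; simp [hp, mul_comm]
    · simp [hp, h.le, h.ne']
  have hpi : ∫ ω, p (X ω) ∂P = q := by
    rw [← integral_map (f := p) hX.aemeasurable hpm.aestronglyMeasurable, hp, integral_add,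
      integral_const_mul, integral_indicator_one measurableSet_Iio,
      integral_indicator_one (measurableSet_singleton θ), hlq]
    · exact (integrable_const (1 : ℝ)).indicator measurableSet_Iio
    · exact ((integrable_const (1 : ℝ)).indicator (measurableSet_singleton θ)).const_mul l
  have hpint : Integrable (fun ω => p (X ω)) P :=
    Integrable.of_bound (hpm.comp_aemeasurable hX.aemeasurable).aestronglyMeasurable 1
      (Eventually.of_forall fun ω => by
        rw [Real.norm_eq_abs, abs_of_nonneg (hp01 _).1]; exact (hp01 _).2)
  refine ⟨p, hpm, hp01, hpi, le_trans (le_of_eq ?_) (hm θ)⟩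
  simp only [hpθ]
  rw [integral_sub (hpint.const_mul θ) (integrable_max_const_sub hX θ), integral_const_mul, hpi]

end NeymanPearson

namespace Game

variable {A : Type u} {Info : Player → Type v} {G : Game A Info}

/-! ### Payoffs in the distributional augmented subgame -/

section DistPayoff

variable {S : G.Subgame} {σ : Profile A Info} {hσ : G.IsStrategy .two (σ .two)}
  {hpos : 0 < ∑ h ∈ S.top, G.reachOther σ .one h}
  {Ω : Type w} [MeasurableSpace Ω] {P : Measure Ω} {X : Info .one → Ω → ℝ}

theorem distPayoff_eq (s₁ : ℝ → Strategy (AugAct A) (AugInfo (Info .one)))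
    (s₂ : Strategy (AugAct A) (AugInfo (Info .two))) :
    distPayoff S σ hσ hpos P X s₁ s₂ = ∑ h ∈ S.top, topProb S σ h *
      ∫ ω, (s₁ (X (G.info .one h) ω) (.root (G.info .one h)) .enter *
          enterValue S σ hσ hpos (s₁ (X (G.info .one h) ω)) s₂ h +
        s₁ (X (G.info .one h) ω) (.root (G.info .one h)) .alt * X (G.info .one h) ω) ∂P := by
  unfold distPayoff
  refine Finset.sum_congr rfl fun h hh => ?_
  simp only [aug_value_start hh]

theorem measurable_enterValue {s₁ : ℝ → Strategy (AugAct A) (AugInfo (Info .one))}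
    (hs : ∀ K a, Measurable fun x => s₁ x K a) (s₂ : Strategy (AugAct A) (AugInfo (Info .two)))
    (h : List A) : Measurable fun x => enterValue S σ hσ hpos (s₁ x) s₂ h := by
  unfold enterValue value
  refine Finset.measurable_sum _ fun z _ => Measurable.mul_const ?_ _
  unfold reachFrom
  split_ifs
  · refine measurable_pathProb (fun g a => ?_) _ _
    unfold stepProb
    cases (aug S σ hσ hpos fun _ => 0).turn g with
    | none => exact measurable_const
    | some i =>
      cases i with
      | one => exact hs _ a
      | two => exact measurable_const
  · exact measurable_const

theorem measurable_reachOwn {s₁ : ℝ → Strategy (AugAct A) (AugInfo (Info .one))}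
    (hs : ∀ K a, Measurable fun x => s₁ x K a) (s₂ : Strategy (AugAct A) (AugInfo (Info .two)))
    (z : List (AugAct A)) : Measurable fun x => (aug S σ hσ hpos fun _ => 0).reachOwn
      (mkProfile (Info := fun i => AugInfo (Info i)) (s₁ x) s₂) .one z := by
  unfold reachOwn
  refine measurable_pathProb (fun g a => ?_) _ _
  by_cases e : (aug S σ hσ hpos fun _ => 0).turn g = some .one
  · simp only [e, if_true, stepProb]
    exact hs _ a
  · simp only [e, if_false]
    exact measurable_const

theorem isStrategy_mkProfile {G' : Game A Info} {s₁ : Strategy A (Info .one)}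
    {s₂ : Strategy A (Info .two)} (h₁ : G'.IsStrategy .one s₁) (h₂ : G'.IsStrategy .two s₂)
    (j : Player) : G'.IsStrategy j (mkProfile s₁ s₂ j) := by
  cases j
  · exact h₁
  · exact h₂

theorem integrable_comp_of_bound [IsFiniteMeasure P] {Y : Ω → ℝ} (hY : Integrable Y P)
    {f : ℝ → ℝ} (hf : Measurable f) {C : ℝ} (hC : ∀ x, |f x| ≤ C) :
    Integrable (fun ω => f (Y ω)) P :=
  Integrable.of_bound (hf.comp_aemeasurable hY.aemeasurable).aestronglyMeasurable C
    (Eventually.of_forall fun ω => hC (Y ω))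

theorem integrable_comp_mul_of_bound [IsFiniteMeasure P] {Y : Ω → ℝ} (hY : Integrable Y P)
    {f : ℝ → ℝ} (hf : Measurable f) {C : ℝ} (hC : ∀ x, |f x| ≤ C) :
    Integrable (fun ω => f (Y ω) * Y ω) P :=
  hY.bdd_mul (hf.comp_aemeasurable hY.aemeasurable).aestronglyMeasurable
    (Eventually.of_forall fun ω => hC (Y ω))

theorem integral_mix [IsFiniteMeasure P] {Y : Ω → ℝ} (hY : Integrable Y P)
    {f : ℝ → ℝ} (hf : Measurable f) {C : ℝ} (hC : ∀ x, |f x| ≤ C) (c : ℝ) :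
    Integrable (fun ω => f (Y ω) * c + (Y ω - f (Y ω) * Y ω)) P ∧
    ∫ ω, (f (Y ω) * c + (Y ω - f (Y ω) * Y ω)) ∂P =
      (∫ ω, f (Y ω) ∂P) * c + (∫ ω, Y ω ∂P - ∫ ω, f (Y ω) * Y ω ∂P) := by
  have h1 : Integrable (fun ω => f (Y ω) * c) P := (integrable_comp_of_bound hY hf hC).mul_const c
  have h2 := integrable_comp_mul_of_bound hY hf hC
  have h3 : Integrable (fun ω => Y ω - f (Y ω) * Y ω) P := hY.sub h2
  exact ⟨h1.add h3, by rw [integral_add h1 h3, integral_mul_const, integral_sub hY h2]⟩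

theorem integral_indicator_Iic [IsFiniteMeasure P] {Y : Ω → ℝ} (hY : Integrable Y P) (θ : ℝ) :
    ∫ ω, (Set.Iic θ).indicator 1 (Y ω) ∂P = P.real {ω | Y ω ≤ θ} := by
  rw [← integral_map (f := (Set.Iic θ).indicator (1 : ℝ → ℝ)) hY.aemeasurable
    (measurable_one.indicator measurableSet_Iic).aestronglyMeasurable,
    integral_indicator_one measurableSet_Iic, measureReal_def, measureReal_def,
    Measure.map_apply_of_aemeasurable hY.aemeasurable measurableSet_Iic]
  rfl

theorem abs_le_one_of_mem_Icc {x : ℝ} (hx : x ∈ Set.Icc (0 : ℝ) 1) : |x| ≤ 1 := by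
  rw [abs_of_nonneg hx.1]
  exact hx.2

theorem IsDistStrategy.root {s₁ : ℝ → Strategy (AugAct A) (AugInfo (Info .one))}
    (hs : IsDistStrategy S σ hσ hpos s₁) {h : List A} (hh : h ∈ S.top) (x : ℝ) :
    s₁ x (.root (G.info .one h)) .enter ∈ Set.Icc (0 : ℝ) 1 ∧
      s₁ x (.root (G.info .one h)) .alt ∈ Set.Icc (0 : ℝ) 1 := by
  obtain ⟨h1, h2, h3⟩ := aug_isStrategy_root (hs.1 x) hh
  exact ⟨⟨h1, by linarith⟩, ⟨h2, by linarith⟩⟩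

theorem IsDistStrategy.integrable_alt [IsProbabilityMeasure P]
    {s₁ : ℝ → Strategy (AugAct A) (AugInfo (Info .one))}
    (hs : IsDistStrategy S σ hσ hpos s₁) {h : List A} (hh : h ∈ S.top)
    (hX : Integrable (X (G.info .one h)) P) :
    Integrable (fun ω => s₁ (X (G.info .one h) ω) (.root (G.info .one h)) .alt *
      X (G.info .one h) ω) P :=
  integrable_comp_mul_of_bound hX (hs.2 (.root (G.info .one h)) .alt)
    fun x => abs_le_one_of_mem_Icc (hs.root hh x).2

theorem IsDistStrategy.integrable_enter [IsProbabilityMeasure P]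
    {s₁ : ℝ → Strategy (AugAct A) (AugInfo (Info .one))}
    (hs : IsDistStrategy S σ hσ hpos s₁) {s₂ : Strategy (AugAct A) (AugInfo (Info .two))}
    (hs₂ : IsDistStrategyTwo S σ hσ hpos s₂) {h : List A} (hh : h ∈ S.top)
    (hX : Integrable (X (G.info .one h)) P) :
    Integrable (fun ω => s₁ (X (G.info .one h) ω) (.root (G.info .one h)) .enter *
      enterValue S σ hσ hpos (s₁ (X (G.info .one h) ω)) s₂ h) P := by
  refine integrable_comp_of_bound hX
    ((hs.2 (.root (G.info .one h)) .enter).mul (measurable_enterValue hs.2 s₂ h))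
    (C := ∑ z ∈ (aug S σ hσ hpos fun _ => 0).terminals,
      |(aug S σ hσ hpos fun _ => 0).util .one z|) fun x => ?_
  rw [Pi.mul_apply, abs_mul]
  refine (mul_le_of_le_one_left (abs_nonneg _) (abs_le_one_of_mem_Icc (hs.root hh x).1)).trans ?_
  exact abs_value_le (isStrategy_mkProfile (hs.1 x) hs₂) _

/-- The payoff depends on the strategy of player two through finitely many reach
probabilities only, and affinely on these. -/
theorem distPayoff_eq_sum_reachOther [IsProbabilityMeasure P]
    (hX : ∀ h ∈ S.top, Integrable (X (G.info .one h)) P)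
    {s₁ : ℝ → Strategy (AugAct A) (AugInfo (Info .one))} (hs : IsDistStrategy S σ hσ hpos s₁)
    (s₀ : Strategy (AugAct A) (AugInfo (Info .one)))
    {s₂ : Strategy (AugAct A) (AugInfo (Info .two))} (hs₂ : IsDistStrategyTwo S σ hσ hpos s₂) :
    distPayoff S σ hσ hpos P X s₁ s₂ = ∑ h ∈ S.top,
      (∑ z ∈ (aug S σ hσ hpos fun _ => 0).terminals with [.start h, .enter] <+: z,
        (∫ ω, (aug S σ hσ hpos fun _ => 0).reachOwn (mkProfile (Info := fun i => AugInfo (Info i))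
          (s₁ (X (G.info .one h) ω)) s₂) .one z ∂P) *
        ((aug S σ hσ hpos fun _ => 0).reachOther (mkProfile (Info := fun i => AugInfo (Info i))
          s₀ s₂) .one z * (aug S σ hσ hpos fun _ => 0).util .one z) +
      topProb S σ h * ∫ ω, s₁ (X (G.info .one h) ω) (.root (G.info .one h)) .alt *
        X (G.info .one h) ω ∂P) := by
  rw [distPayoff_eq]
  refine Finset.sum_congr rfl fun h hh => ?_
  rw [integral_add (hs.integrable_enter hs₂ hh (hX h hh)) (hs.integrable_alt hh (hX h hh)),
    mul_add]
  congr 1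
  rw [← integral_const_mul]
  have h1 : ∀ ω, topProb S σ h * (s₁ (X (G.info .one h) ω) (.root (G.info .one h)) .enter *
      enterValue S σ hσ hpos (s₁ (X (G.info .one h) ω)) s₂ h) =
      ∑ z ∈ (aug S σ hσ hpos fun _ => 0).terminals with [.start h, .enter] <+: z,
        (aug S σ hσ hpos fun _ => 0).reachOwn (mkProfile (Info := fun i => AugInfo (Info i))
          (s₁ (X (G.info .one h) ω)) s₂) .one z *
        ((aug S σ hσ hpos fun _ => 0).reachOther (mkProfile (Info := fun i => AugInfo (Info i))
          s₀ s₂) .one z * (aug S σ hσ hpos fun _ => 0).util .one z) := by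
    intro ω
    have h2 := reachFrom_mul_value (G := aug S σ hσ hpos fun _ => 0)
      (σ := mkProfile (Info := fun i => AugInfo (Info i)) (s₁ (X (G.info .one h) ω)) s₂) .one .one
      [.start h, .enter]
    rw [aug_reachFrom_enter, aug_value_enter_eq, mkProfile_one, mkProfile_two] at h2
    rw [← mul_assoc, h2]
    refine Finset.sum_congr rfl fun z _ => ?_
    rw [mul_assoc, reachOther_congr (G := aug S σ hσ hpos fun _ => 0) (i := .one)
      (σ := mkProfile (Info := fun i => AugInfo (Info i)) (s₁ (X (G.info .one h) ω)) s₂)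
      (τ := mkProfile (Info := fun i => AugInfo (Info i)) s₀ s₂)]
    intro j hj
    cases j with
    | one => exact absurd rfl hj
    | two => rfl
  simp only [h1]
  rw [integral_finsetSum]
  · simp only [integral_mul_const]
  · intro z hz
    refine Integrable.mul_const ?_ _
    refine integrable_comp_of_bound (hX h hh) (measurable_reachOwn hs.2 s₂ z) (C := 1) fun x => ?_
    exact abs_le_one_of_mem_Icc (reachOwn_mem_Icc (hs.1 x)
      (mem_terminals.1 (Finset.mem_filter.1 hz).1).1)

theorem tendsto_stepProb {G' : Game A Info} {ι : Type*} {l : Filter ι} {τ : ι → Profile A Info}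
    {τ' : Profile A Info} (hτ : ∀ j K a, Tendsto (fun n => τ n j K a) l (𝓝 (τ' j K a)))
    (g : List A) (a : A) : Tendsto (fun n => G'.stepProb (τ n) g a) l (𝓝 (G'.stepProb τ' g a)) := by
  unfold stepProb
  cases G'.turn g with
  | none => exact tendsto_const_nhds
  | some i => exact hτ i _ a

theorem tendsto_value {G' : Game A Info} {ι : Type*} {l : Filter ι} {τ : ι → Profile A Info}
    {τ' : Profile A Info} (hτ : ∀ j K a, Tendsto (fun n => τ n j K a) l (𝓝 (τ' j K a)))
    (i : Player) (h : List A) :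
    Tendsto (fun n => G'.value (τ n) i h) l (𝓝 (G'.value τ' i h)) := by
  unfold value
  refine tendsto_finsetSum _ fun z _ => Tendsto.mul_const _ ?_
  unfold reachFrom
  split_ifs
  · exact tendsto_pathProb (tendsto_stepProb hτ) _ _
  · exact tendsto_const_nhds

theorem tendsto_reachOther {G' : Game A Info} {ι : Type*} {l : Filter ι} {τ : ι → Profile A Info}
    {τ' : Profile A Info} (hτ : ∀ j K a, Tendsto (fun n => τ n j K a) l (𝓝 (τ' j K a)))
    (i : Player) (h : List A) :
    Tendsto (fun n => G'.reachOther (τ n) i h) l (𝓝 (G'.reachOther τ' i h)) := by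
  unfold reachOther
  refine tendsto_pathProb (fun g a => ?_) _ _
  split_ifs
  · exact tendsto_const_nhds
  · exact tendsto_stepProb hτ g a

theorem isStrategy_of_tendsto {G' : Game A Info} {i : Player} {ι : Type*} {l : Filter ι} [l.NeBot]
    {s : ι → Strategy A (Info i)} {s' : Strategy A (Info i)} (hs : ∀ n, G'.IsStrategy i (s n))
    (h : ∀ K a, Tendsto (fun n => s n K a) l (𝓝 (s' K a))) : G'.IsStrategy i s' := by
  intro g hg ht ha
  refine ⟨fun a => ge_of_tendsto (h _ a) (Eventually.of_forall fun n => (hs n g hg ht ha).1 a),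
    fun a h1 => ?_, ?_⟩
  · exact tendsto_nhds_unique (h _ a) (tendsto_const_nhds.congr fun n =>
      ((hs n g hg ht ha).2.1 a h1).symm)
  · exact tendsto_nhds_unique (tendsto_finsetSum _ fun a _ => h _ a)
      (tendsto_const_nhds.congr fun n => ((hs n g hg ht ha).2.2).symm)

theorem tendsto_distPayoff [IsProbabilityMeasure P]
    (hX : ∀ h ∈ S.top, Integrable (X (G.info .one h)) P)
    {s₁ : ℝ → Strategy (AugAct A) (AugInfo (Info .one))} (hs : IsDistStrategy S σ hσ hpos s₁)
    {ι : Type*} {l : Filter ι} [l.NeBot] {s₂ : ι → Strategy (AugAct A) (AugInfo (Info .two))}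
    {s₂' : Strategy (AugAct A) (AugInfo (Info .two))}
    (hs₂ : ∀ n, IsDistStrategyTwo S σ hσ hpos (s₂ n))
    (h : ∀ K a, Tendsto (fun n => s₂ n K a) l (𝓝 (s₂' K a))) :
    Tendsto (fun n => distPayoff S σ hσ hpos P X s₁ (s₂ n)) l
      (𝓝 (distPayoff S σ hσ hpos P X s₁ s₂')) := by
  simp only [distPayoff_eq_sum_reachOther hX hs (fun _ _ => 0) (hs₂ _)]
  rw [distPayoff_eq_sum_reachOther hX hs (fun _ _ => 0) (isStrategy_of_tendsto hs₂ h)]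
  refine tendsto_finsetSum _ fun h₀ _ => Tendsto.add_const _ (tendsto_finsetSum _ fun z _ => ?_)
  have h1 : ∀ (x : ℝ) n, (aug S σ hσ hpos fun _ => 0).reachOwn
      (mkProfile (Info := fun i => AugInfo (Info i)) (s₁ x) (s₂ n)) .one z =
      (aug S σ hσ hpos fun _ => 0).reachOwn
      (mkProfile (Info := fun i => AugInfo (Info i)) (s₁ x) s₂') .one z := fun x n => by
    rw [reachOwn_congr]
    rfl
  simp only [h1]
  refine Tendsto.const_mul _ (Tendsto.mul_const _ (tendsto_reachOther (fun j K a => ?_) _ _))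
  cases j with
  | one => exact tendsto_const_nhds
  | two => exact h K a

/-! ### Strategies that use the observed alternative payoff at the root only -/

/-- The strategy of player one in the distributional augmented subgame that enters the subgame,
from the information set `J`, with probability `p J x` if `x` is observed, and forgets `x`
afterwards, following `s`. -/
def rootMix (p : Info .one → ℝ → ℝ) (s : Strategy (AugAct A) (AugInfo (Info .one))) :
    ℝ → Strategy (AugAct A) (AugInfo (Info .one))
  | x, .root J, .enter => p J x
  | x, .root J, .alt => 1 - p J x
  | _, .root _, _ => 0
  | _, K, a => s K a

variable {p : Info .one → ℝ → ℝ} {s : Strategy (AugAct A) (AugInfo (Info .one))}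

theorem rootMix_sub (x : ℝ) (K : Info .one) : rootMix p s x (.sub K) = s (.sub K) :=
  rfl

theorem isDistStrategy_rootMix (hp : ∀ J, Measurable (p J))
    (hp01 : ∀ J x, p J x ∈ Set.Icc (0 : ℝ) 1)
    (hs : (aug S σ hσ hpos fun _ => 0).IsStrategy .one s) :
    IsDistStrategy S σ hσ hpos (rootMix p s) := by
  refine ⟨fun x y hy ht ha => ?_, fun K a => ?_⟩
  · rcases augTurn_eq_some hy ht with ⟨h, hh, rfl, -⟩ | ⟨h, hh, w, hw, rfl⟩
    · rw [aug_acts_start hh]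
      change (∀ a, 0 ≤ rootMix p s x (.root (G.info .one h)) a) ∧
        (∀ a, a ∉ _ → rootMix p s x (.root (G.info .one h)) a = 0) ∧
        ∑ a ∈ _, rootMix p s x (.root (G.info .one h)) a = 1
      refine ⟨fun a => ?_, fun a h1 => ?_, ?_⟩
      · cases a with
        | enter => exact (hp01 _ x).1
        | alt => exact sub_nonneg.2 (hp01 _ x).2
        | start _ => exact le_rfl
        | act _ => exact le_rfl
      · cases a with
        | enter => simp at h1
        | alt => simp at h1
        | start _ => rfl
        | act _ => rfl
      · rw [Finset.sum_pair (by simp)]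
        exact add_sub_cancel _ _
    · have h1 : (aug S σ hσ hpos fun _ => 0).info .one
          (AugAct.start h :: AugAct.enter :: w.map AugAct.act) = .sub (G.info .one (h ++ w)) :=
        augInfo_enter .one h w
      have h2 := hs _ hy ht ha
      rw [h1] at h2 ⊢
      rwa [rootMix_sub]
  · cases K with
    | root J =>
      cases a with
      | enter => exact hp J
      | alt => exact measurable_const.sub (hp J)
      | start _ => exact measurable_const
      | act _ => exact measurable_const
    | pre => exact measurable_const
    | out J => exact measurable_const
    | sub J => exact measurable_const

theorem enterValue_rootMix (x : ℝ) (s₂ : Strategy (AugAct A) (AugInfo (Info .two))) (h : List A) :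
    enterValue S σ hσ hpos (rootMix p s x) s₂ h = enterValue S σ hσ hpos s s₂ h := by
  rw [enterValue]
  exact aug_value_enter (fun K => by rw [mkProfile_one, rootMix_sub]) (fun _ => rfl) h

theorem distPayoff_rootMix [IsProbabilityMeasure P]
    (hX : ∀ h ∈ S.top, Integrable (X (G.info .one h)) P) (hp : ∀ J, Measurable (p J))
    (hp01 : ∀ J x, p J x ∈ Set.Icc (0 : ℝ) 1) (s₂ : Strategy (AugAct A) (AugInfo (Info .two))) :
    distPayoff S σ hσ hpos P X (rootMix p s) s₂ = ∑ h ∈ S.top, topProb S σ h *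
      ((∫ ω, p (G.info .one h) (X (G.info .one h) ω) ∂P) * enterValue S σ hσ hpos s s₂ h +
        (∫ ω, X (G.info .one h) ω ∂P -
          ∫ ω, p (G.info .one h) (X (G.info .one h) ω) * X (G.info .one h) ω ∂P)) := by
  rw [distPayoff_eq]
  refine Finset.sum_congr rfl fun h hh => ?_
  simp only [enterValue_rootMix, rootMix, sub_mul, one_mul]
  rw [(integral_mix (hX h hh) (hp (G.info .one h)) (fun x => abs_le_one_of_mem_Icc (hp01 _ x))
    _).2]

end DistPayoff

/-! ### The average strategies as approximate and limiting equilibria -/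

section Gap

variable {S : G.Subgame} {σ : Profile A Info} {hσ : G.IsStrategy .two (σ .two)}
  {hpos : 0 < ∑ h ∈ S.top, G.reachOther σ .one h} {altPay : Info .one → ℝ}
  {Ω : Type w} [MeasurableSpace Ω] {P : Measure Ω} {X : Info .one → Ω → ℝ}

theorem isDistStrategyTwo_gadgetCFR [IsProbabilityMeasure P] (hG : G.PerfectRecall) (T : ℕ) :
    IsDistStrategyTwo S σ hσ hpos (gadgetCFR S σ hσ hpos altPay P X T) :=
  isStrategy_averageStrategy (perfectRecall_aug S σ hσ hpos hG altPay)
    (fun t => isStrategy_gadgetProfile S σ hσ hpos altPay P X t .two) T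

theorem isStrategy_gadgetCFROne [IsProbabilityMeasure P] (hG : G.PerfectRecall) (T : ℕ) :
    (aug S σ hσ hpos fun _ => 0).IsStrategy .one (gadgetCFROne S σ hσ hpos altPay P X T) :=
  isStrategy_averageStrategy (perfectRecall_aug S σ hσ hpos hG altPay)
    (fun t => isStrategy_gadgetProfile S σ hσ hpos altPay P X t .one) T

variable (S σ hσ hpos altPay P X) in
/-- The payoff of the iteration `t` when `x` is observed and `h` selected: player one takes the
better, in expectation at the information set, of entering and the alternative payoff `x`. -/
def gadgetOutcome (t : ℕ) (h : List A) (x : ℝ) : ℝ :=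
  if x ≤ gadgetThreshold S σ hσ hpos altPay P X t (G.info .one h) then
    gadgetValue S σ hσ hpos altPay P X t h else x

variable (S σ hσ hpos altPay P X) in
/-- The total expected payoff of the first `T` iterations in the distributional augmented
subgame. -/
def gadgetTotal (T : ℕ) : ℝ :=
  ∑ t ∈ Finset.range T, ∑ h ∈ S.top, topProb S σ h *
    ∫ ω, gadgetOutcome S σ hσ hpos altPay P X t h (X (G.info .one h) ω) ∂P

/-- The root decision of each iteration is a best response to the value of entering. -/
theorem sum_root_le_gadgetOutcome (t : ℕ) (J : Info .one) {e a : ℝ} (he : 0 ≤ e) (ha : 0 ≤ a)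
    (hea : e + a = 1) (x : ℝ) :
    ∑ h ∈ S.top with G.info .one h = J, topProb S σ h *
        (e * gadgetValue S σ hσ hpos altPay P X t h + a * x) ≤
      ∑ h ∈ S.top with G.info .one h = J, topProb S σ h *
        gadgetOutcome S σ hσ hpos altPay P X t h x := by
  have h1 := sum_topProb_mul_gadgetValue S σ hσ hpos altPay P X t J
  have h0 : 0 ≤ ∑ h ∈ S.top with G.info .one h = J, topProb S σ h :=
    Finset.sum_nonneg fun h hh => topProb_nonneg hσ hpos (Finset.mem_filter.1 hh).1
  set c := ∑ h ∈ S.top with G.info .one h = J, topProb S σ h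
  set θ := gadgetThreshold S σ hσ hpos altPay P X t J with hθ
  have h2 : ∑ h ∈ S.top with G.info .one h = J, topProb S σ h *
      (e * gadgetValue S σ hσ hpos altPay P X t h + a * x) = c * (e * θ + a * x) := by
    calc _ = e * ∑ h ∈ S.top with G.info .one h = J, topProb S σ h *
          gadgetValue S σ hσ hpos altPay P X t h + a * x * c := by
          rw [Finset.mul_sum, Finset.mul_sum, ← Finset.sum_add_distrib]
          exact Finset.sum_congr rfl fun h _ => by ring
      _ = _ := by rw [h1]; ring
  have h3 : ∑ h ∈ S.top with G.info .one h = J, topProb S σ h *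
      gadgetOutcome S σ hσ hpos altPay P X t h x = c * (if x ≤ θ then θ else x) := by
    have h4 : ∀ h ∈ S.top.filter (fun h => G.info .one h = J), topProb S σ h *
        gadgetOutcome S σ hσ hpos altPay P X t h x = topProb S σ h *
          (if x ≤ θ then gadgetValue S σ hσ hpos altPay P X t h else x) := fun h hh => by
      rw [gadgetOutcome, (Finset.mem_filter.1 hh).2]
    rw [Finset.sum_congr rfl h4]
    split_ifs
    · exact h1
    · rw [← Finset.sum_mul]
  rw [h2, h3]
  refine mul_le_mul_of_nonneg_left ?_ h0
  obtain rfl : a = 1 - e := by linarith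
  split_ifs with h
  · nlinarith
  · nlinarith

theorem abs_indicator_Iic_le (θ x : ℝ) : |(Set.Iic θ).indicator (1 : ℝ → ℝ) x| ≤ 1 := by
  by_cases e : x ≤ θ <;> simp [e]

variable (S σ hσ hpos altPay P X) in
/-- The frequency, over the first `T` iterations, with which player one enters the subgame from
the root information set that belongs to `J` when `x` is observed. -/
def enterFrequency (T : ℕ) (J : Info .one) (x : ℝ) : ℝ :=
  (∑ t ∈ Finset.range T,
    (Set.Iic (gadgetThreshold S σ hσ hpos altPay P X t J)).indicator 1 x) / T

theorem measurable_enterFrequency (T : ℕ) (J : Info .one) :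
    Measurable (enterFrequency S σ hσ hpos altPay P X T J) :=
  (Finset.measurable_sum _ fun _ _ => measurable_one.indicator measurableSet_Iic).div_const _

theorem enterFrequency_mem_Icc (T : ℕ) (J : Info .one) (x : ℝ) :
    enterFrequency S σ hσ hpos altPay P X T J x ∈ Set.Icc (0 : ℝ) 1 := by
  refine ⟨div_nonneg (Finset.sum_nonneg fun _ _ => Set.indicator_nonneg (by simp) _)
    (Nat.cast_nonneg _), div_le_one_of_le₀ ?_ (Nat.cast_nonneg _)⟩
  calc _ ≤ ∑ t ∈ Finset.range T, (1 : ℝ) := Finset.sum_le_sum fun t _ =>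
        (le_abs_self _).trans (abs_indicator_Iic_le _ x)
    _ = T := by simp

variable [IsProbabilityMeasure P]

/-- Averaged over the observation, the threshold decision of iteration `t` is the modified root
decision of the algorithm. -/
theorem integral_gadgetOutcome (t : ℕ) {h : List A} (hX : Integrable (X (G.info .one h)) P) :
    Integrable (fun ω => gadgetOutcome S σ hσ hpos altPay P X t h (X (G.info .one h) ω)) P ∧
    ∫ ω, gadgetOutcome S σ hσ hpos altPay P X t h (X (G.info .one h) ω) ∂P =
      gadgetProfile S σ hσ hpos altPay P X t .one (.root (G.info .one h)) .enter *
        gadgetValue S σ hσ hpos altPay P X t h + (∫ ω, X (G.info .one h) ω ∂P -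
        ∫ ω, (Set.Iic (gadgetThreshold S σ hσ hpos altPay P X t (G.info .one h))).indicator 1
          (X (G.info .one h) ω) * X (G.info .one h) ω ∂P) := by
  have h3 : ∀ x, gadgetOutcome S σ hσ hpos altPay P X t h x =
      (Set.Iic (gadgetThreshold S σ hσ hpos altPay P X t (G.info .one h))).indicator 1 x *
        gadgetValue S σ hσ hpos altPay P X t h +
      (x - (Set.Iic (gadgetThreshold S σ hσ hpos altPay P X t (G.info .one h))).indicator 1 x * x)
      := by
    intro x
    unfold gadgetOutcome
    split_ifs with e <;> simp [e]
  simp only [h3]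
  have h4 := integral_mix hX (f := (Set.Iic (gadgetThreshold S σ hσ hpos altPay P X t
    (G.info .one h))).indicator 1) (measurable_one.indicator measurableSet_Iic)
    (abs_indicator_Iic_le _) (gadgetValue S σ hσ hpos altPay P X t h)
  rw [integral_indicator_Iic hX, ← gadgetProfile_root_enter] at h4
  exact h4

/-- Player one cannot gain much against the average strategy of player two: up to the regret
below a root information set, no strategy does better there than the iterations did. -/
theorem exists_root_payoff_le (hG : G.PerfectRecall) (J : Info .one) :
    ∃ C : ℝ, ∀ (T : ℕ) (s : Strategy (AugAct A) (AugInfo (Info .one))),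
      (aug S σ hσ hpos altPay).IsStrategy .one s → ∀ x : ℝ,
      T * ∑ h ∈ S.top with G.info .one h = J, topProb S σ h *
          (s (.root (G.info .one h)) .enter *
            enterValue S σ hσ hpos s (gadgetCFR S σ hσ hpos altPay P X T) h +
            s (.root (G.info .one h)) .alt * x) ≤
        C * √T + ∑ t ∈ Finset.range T, ∑ h ∈ S.top with G.info .one h = J, topProb S σ h *
          gadgetOutcome S σ hσ hpos altPay P X t h x := by
  obtain ⟨C, hC⟩ := exists_gadget_regret_one_le (S := S) (σ := σ) (hσ := hσ) (hpos := hpos)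
    (altPay := altPay) (P := P) (X := X) hG J
  refine ⟨C, fun T s hs x => ?_⟩
  rcases (S.top.filter fun h => G.info .one h = J).eq_empty_or_nonempty with e | ⟨h₀, hh₀⟩
  · have := hC T s hs
    simp only [e, Finset.sum_empty, mul_zero, Finset.sum_const_zero, add_zero] at this ⊢
    exact this
  obtain ⟨hh₀, hJ⟩ := Finset.mem_filter.1 hh₀
  obtain ⟨he, ha, hea⟩ := aug_isStrategy_root hs hh₀
  rw [hJ] at he ha hea
  calc T * ∑ h ∈ S.top with G.info .one h = J, topProb S σ h *
          (s (.root (G.info .one h)) .enter *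
            enterValue S σ hσ hpos s (gadgetCFR S σ hσ hpos altPay P X T) h +
            s (.root (G.info .one h)) .alt * x)
      = ∑ t ∈ Finset.range T, ∑ h ∈ S.top with G.info .one h = J,
          (topProb S σ h * s (.root J) .enter * (enterValue S σ hσ hpos s
            (gadgetProfile S σ hσ hpos altPay P X t .two) h -
            gadgetValue S σ hσ hpos altPay P X t h) + topProb S σ h *
            (s (.root J) .enter * gadgetValue S σ hσ hpos altPay P X t h +
              s (.root J) .alt * x)) := by
        rw [Finset.mul_sum, Finset.sum_comm]
        refine Finset.sum_congr rfl fun h hh => ?_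
        have h1 := enterValue_gadgetCFR (S := S) (σ := σ) (hσ := hσ) (hpos := hpos)
          (altPay := altPay) (P := P) (X := X) hG T s h
        rw [(Finset.mem_filter.1 hh).2] at h1 ⊢
        rw [mul_add, mul_add, ← mul_assoc (topProb S σ h) (s (.root J) .enter), h1]
        have h2 : (T : ℝ) * (topProb S σ h * (s (.root J) .alt * x)) =
            ∑ t ∈ Finset.range T, topProb S σ h * (s (.root J) .alt * x) := by
          rw [Finset.sum_const, Finset.card_range, nsmul_eq_mul]
        rw [h2, ← Finset.sum_add_distrib]
        exact Finset.sum_congr rfl fun t _ => by ring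
    _ ≤ _ := by
        simp only [Finset.sum_add_distrib]
        exact add_le_add (hC T s hs)
          (Finset.sum_le_sum fun t _ => sum_root_le_gadgetOutcome t J he ha hea x)

/-- No strategy of player one earns, against the average strategy of player two, substantially
more than the iterations did on average. -/
theorem exists_distPayoff_gadgetCFR_le (hG : G.PerfectRecall)
    (hX : ∀ h ∈ S.top, Integrable (X (G.info .one h)) P) :
    ∃ C : ℝ, ∀ (T : ℕ) (s₁ : ℝ → Strategy (AugAct A) (AugInfo (Info .one))),
      IsDistStrategy S σ hσ hpos s₁ →
      T * distPayoff S σ hσ hpos P X s₁ (gadgetCFR S σ hσ hpos altPay P X T) ≤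
        C * √T + gadgetTotal S σ hσ hpos altPay P X T := by
  choose C hC using exists_root_payoff_le (S := S) (σ := σ) (hσ := hσ) (hpos := hpos)
    (altPay := altPay) (P := P) (X := X) hG
  refine ⟨∑ J ∈ S.top.image (G.info .one), C J, fun T s₁ hs => ?_⟩
  have hm : ∀ h ∈ S.top, G.info .one h ∈ S.top.image (G.info .one) :=
    fun h hh => Finset.mem_image_of_mem _ hh
  rw [distPayoff_eq, gadgetTotal, Finset.sum_comm, ← Finset.sum_fiberwise_of_maps_to hm,
    ← Finset.sum_fiberwise_of_maps_to hm, Finset.mul_sum, Finset.sum_mul,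
    ← Finset.sum_add_distrib]
  refine Finset.sum_le_sum fun J _ => ?_
  rcases (S.top.filter fun h => G.info .one h = J).eq_empty_or_nonempty with e | ⟨h₀, hh₀⟩
  · have := hC J T (s₁ 0) (hs.1 0) 0
    simp only [e, Finset.sum_empty, mul_zero, Finset.sum_const_zero, add_zero] at this ⊢
    exact this
  obtain ⟨hh₀, hJ⟩ := Finset.mem_filter.1 hh₀
  have hXJ : Integrable (X J) P := hJ ▸ hX h₀ hh₀
  have hl : ∀ h ∈ S.top.filter (fun h => G.info .one h = J), Integrable (fun ω =>
      topProb S σ h * (s₁ (X J ω) (.root (G.info .one h)) .enter *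
          enterValue S σ hσ hpos (s₁ (X J ω)) (gadgetCFR S σ hσ hpos altPay P X T) h +
        s₁ (X J ω) (.root (G.info .one h)) .alt * X J ω)) P := by
    intro h hh
    obtain ⟨hh', rfl⟩ := Finset.mem_filter.1 hh
    exact ((hs.integrable_enter (isDistStrategyTwo_gadgetCFR hG T) hh' (hX h hh')).add
      (hs.integrable_alt hh' (hX h hh'))).const_mul _
  have hr : ∀ t, ∀ h ∈ S.top.filter (fun h => G.info .one h = J), Integrable (fun ω =>
      topProb S σ h * gadgetOutcome S σ hσ hpos altPay P X t h (X J ω)) P := by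
    intro t h hh
    obtain ⟨hh', rfl⟩ := Finset.mem_filter.1 hh
    exact (integral_gadgetOutcome t (hX h hh')).1.const_mul _
  have h1 : ∫ ω, (T : ℝ) * ∑ h ∈ S.top with G.info .one h = J, topProb S σ h *
        (s₁ (X J ω) (.root (G.info .one h)) .enter *
          enterValue S σ hσ hpos (s₁ (X J ω)) (gadgetCFR S σ hσ hpos altPay P X T) h +
        s₁ (X J ω) (.root (G.info .one h)) .alt * X J ω) ∂P ≤
      ∫ ω, (C J * √T + ∑ t ∈ Finset.range T, ∑ h ∈ S.top with G.info .one h = J,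
        topProb S σ h * gadgetOutcome S σ hσ hpos altPay P X t h (X J ω)) ∂P :=
    integral_mono ((integrable_finsetSum _ hl).const_mul _) ((integrable_const _).add
      (integrable_finsetSum _ fun t _ => integrable_finsetSum _ (hr t)))
      fun ω => hC J T (s₁ (X J ω)) (hs.1 _) (X J ω)
  rw [integral_const_mul, integral_finsetSum _ hl, integral_add (integrable_const _)
    (integrable_finsetSum _ fun t _ => integrable_finsetSum _ (hr t)),
    integral_finsetSum _ (fun t _ => integrable_finsetSum _ (hr t)),
    Finset.sum_congr rfl fun t _ => integral_finsetSum _ (hr t)] at h1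
  simp only [integral_const_mul, integral_const, probReal_univ, one_smul] at h1
  rw [Finset.sum_comm (s := S.top.filter fun h => G.info .one h = J)]
  refine le_trans (le_of_eq ?_) (h1.trans (le_of_eq ?_))
  · congr 1
    refine Finset.sum_congr rfl fun h hh => ?_
    obtain ⟨-, rfl⟩ := Finset.mem_filter.1 hh
    rfl
  · congr 1
    refine Finset.sum_congr rfl fun t _ => Finset.sum_congr rfl fun h hh => ?_
    obtain ⟨-, rfl⟩ := Finset.mem_filter.1 hh
    rfl

/-- Averaged over the observation, the entering frequency is the entering probability of the CFR
average strategy. -/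
theorem integral_enterFrequency (hG : G.PerfectRecall) {T : ℕ} (hT : 0 < T) {h : List A}
    (hh : h ∈ S.top) (hX : Integrable (X (G.info .one h)) P) :
    ∫ ω, enterFrequency S σ hσ hpos altPay P X T (G.info .one h) (X (G.info .one h) ω) ∂P =
      gadgetCFROne S σ hσ hpos altPay P X T (.root (G.info .one h)) .enter := by
  have hT' : (T : ℝ) ≠ 0 := by exact_mod_cast hT.ne'
  unfold enterFrequency
  rw [integral_div, integral_finsetSum, div_eq_iff hT', mul_comm, gadgetCFROne_root_enter hG hT hh]
  · exact Finset.sum_congr rfl fun t _ => integral_indicator_Iic hX _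
  · exact fun t _ => integrable_comp_of_bound hX (measurable_one.indicator measurableSet_Iic)
      (abs_indicator_Iic_le _)

theorem integral_enterFrequency_mul {T : ℕ} (hT : 0 < T) {J : Info .one}
    (hX : Integrable (X J) P) :
    T * ∫ ω, enterFrequency S σ hσ hpos altPay P X T J (X J ω) * X J ω ∂P =
      ∑ t ∈ Finset.range T, ∫ ω,
        (Set.Iic (gadgetThreshold S σ hσ hpos altPay P X t J)).indicator 1 (X J ω) * X J ω ∂P := by
  have hT' : (T : ℝ) ≠ 0 := by exact_mod_cast hT.ne'
  rw [← integral_const_mul, ← integral_finsetSum]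
  · congr 1
    funext ω
    rw [enterFrequency, ← mul_assoc, mul_div_cancel₀ _ hT', Finset.sum_mul]
  · exact fun t _ => integrable_comp_mul_of_bound hX (measurable_one.indicator measurableSet_Iic)
      (abs_indicator_Iic_le _)

variable (S σ hσ hpos altPay P X) in
/-- The average strategy of player one in the distributional augmented subgame. After entering it
is the CFR average of the augmented subgame, in which the observation has been averaged out. -/
def gadgetDistOne (T : ℕ) : ℝ → Strategy (AugAct A) (AugInfo (Info .one)) :=
  rootMix (enterFrequency S σ hσ hpos altPay P X T) (gadgetCFROne S σ hσ hpos altPay P X T)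

theorem isDistStrategy_gadgetDistOne (hG : G.PerfectRecall) (T : ℕ) :
    IsDistStrategy S σ hσ hpos (gadgetDistOne S σ hσ hpos altPay P X T) :=
  isDistStrategy_rootMix (measurable_enterFrequency T) (enterFrequency_mem_Icc T)
    (isStrategy_gadgetCFROne hG T)

theorem distPayoff_gadgetDistOne (hG : G.PerfectRecall)
    (hX : ∀ h ∈ S.top, Integrable (X (G.info .one h)) P) {T : ℕ} (hT : 0 < T)
    (s₂ : Strategy (AugAct A) (AugInfo (Info .two))) :
    distPayoff S σ hσ hpos P X (gadgetDistOne S σ hσ hpos altPay P X T) s₂ =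
      ∑ h ∈ S.top, topProb S σ h *
        (gadgetCFROne S σ hσ hpos altPay P X T (.root (G.info .one h)) .enter *
          enterValue S σ hσ hpos (gadgetCFROne S σ hσ hpos altPay P X T) s₂ h +
        (∫ ω, X (G.info .one h) ω ∂P - ∫ ω, enterFrequency S σ hσ hpos altPay P X T
          (G.info .one h) (X (G.info .one h) ω) * X (G.info .one h) ω ∂P)) := by
  rw [gadgetDistOne, distPayoff_rootMix hX (measurable_enterFrequency T) (enterFrequency_mem_Icc T)]
  exact Finset.sum_congr rfl fun h hh => by rw [integral_enterFrequency hG hT hh (hX h hh)]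

/-- No strategy of player two holds the average strategy of player one substantially below what
the iterations earned on average. -/
theorem exists_le_distPayoff_gadgetDistOne (hG : G.PerfectRecall)
    (hX : ∀ h ∈ S.top, Integrable (X (G.info .one h)) P) :
    ∃ C : ℝ, ∀ (T : ℕ), 0 < T → ∀ s₂ : Strategy (AugAct A) (AugInfo (Info .two)),
      IsDistStrategyTwo S σ hσ hpos s₂ →
      gadgetTotal S σ hσ hpos altPay P X T ≤
        C * √T + T * distPayoff S σ hσ hpos P X (gadgetDistOne S σ hσ hpos altPay P X T) s₂ := by
  obtain ⟨C, hC⟩ := exists_gadget_regret_two_le (S := S) (σ := σ) (hσ := hσ) (hpos := hpos)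
    (altPay := altPay) (P := P) (X := X) hG
  refine ⟨C, fun T hT s₂ hs => ?_⟩
  rw [← sub_le_iff_le_add]
  refine le_trans (le_of_eq ?_) (hC T s₂ hs)
  rw [distPayoff_gadgetDistOne hG hX hT, gadgetTotal, Finset.mul_sum, Finset.sum_comm,
    ← Finset.sum_sub_distrib, Finset.sum_comm (s := Finset.range T)]
  refine Finset.sum_congr rfl fun h hh => ?_
  have h1 := enterValue_gadgetCFROne (S := S) (σ := σ) (hσ := hσ) (hpos := hpos)
    (altPay := altPay) (P := P) (X := X) hG T s₂ h
  have h2 := integral_enterFrequency_mul (S := S) (σ := σ) (hσ := hσ) (hpos := hpos)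
    (altPay := altPay) hT (hX h hh)
  have h3 : (T : ℝ) * ∫ ω, X (G.info .one h) ω ∂P =
      ∑ t ∈ Finset.range T, ∫ ω, X (G.info .one h) ω ∂P := by
    rw [Finset.sum_const, Finset.card_range, nsmul_eq_mul]
  rw [mul_add, mul_add, ← mul_assoc (topProb S σ h), h1, mul_left_comm, mul_sub, h2, h3,
    ← Finset.sum_sub_distrib, Finset.mul_sum, ← Finset.sum_add_distrib, ← Finset.sum_sub_distrib]
  refine Finset.sum_congr rfl fun t _ => ?_
  rw [(integral_gadgetOutcome t (hX h hh)).2]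
  ring

/-- The average strategies are an approximate saddle point of the distributional augmented
subgame. -/
theorem exists_gap_le (hG : G.PerfectRecall)
    (hX : ∀ h ∈ S.top, Integrable (X (G.info .one h)) P) :
    ∃ C : ℝ, ∀ T : ℕ, 0 < T → ∀ s₁, IsDistStrategy S σ hσ hpos s₁ →
      ∀ s₂, IsDistStrategyTwo S σ hσ hpos s₂ →
      distPayoff S σ hσ hpos P X s₁ (gadgetCFR S σ hσ hpos altPay P X T) ≤
        distPayoff S σ hσ hpos P X (gadgetDistOne S σ hσ hpos altPay P X T) s₂ + C / √T := by
  obtain ⟨C₁, h₁⟩ := exists_distPayoff_gadgetCFR_le (altPay := altPay) (hσ := hσ) (hpos := hpos)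
    hG hX
  obtain ⟨C₂, h₂⟩ := exists_le_distPayoff_gadgetDistOne (altPay := altPay) (hσ := hσ)
    (hpos := hpos) hG hX
  refine ⟨C₁ + C₂, fun T hT s₁ hs₁ s₂ hs₂ => ?_⟩
  have hT' : (0 : ℝ) < T := by exact_mod_cast hT
  have h3 := (h₁ T s₁ hs₁).trans (add_le_add_right (h₂ T hT s₂ hs₂) _)
  refine le_of_mul_le_mul_left (h3.trans (le_of_eq ?_)) hT'
  have h4 : (T : ℝ) * ((C₁ + C₂) / √T) = (C₁ + C₂) * √T := by
    rw [mul_div_assoc', div_eq_iff (Real.sqrt_pos.2 hT').ne', mul_assoc,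
      Real.mul_self_sqrt hT'.le, mul_comm]
  rw [mul_add, h4]
  ring

theorem exists_isDistEpsNash (hG : G.PerfectRecall)
    (hX : ∀ h ∈ S.top, Integrable (X (G.info .one h)) P) {ε : ℝ} (hε : 0 < ε) :
    ∀ᶠ T in atTop, ∃ s₁, IsDistEpsNash S σ hσ hpos P X ε s₁
      (gadgetCFR S σ hσ hpos altPay P X T) := by
  obtain ⟨C, hC⟩ := exists_gap_le (altPay := altPay) (hσ := hσ) (hpos := hpos) hG hX
  have h1 : Tendsto (fun T : ℕ => C / √(T : ℝ)) atTop (𝓝 0) :=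
    tendsto_const_nhds.div_atTop (Real.tendsto_sqrt_atTop.comp tendsto_natCast_atTop_atTop)
  filter_upwards [h1.eventually_lt_const hε, eventually_gt_atTop 0] with T hT hT0
  have hd := isDistStrategy_gadgetDistOne (S := S) (σ := σ) (hσ := hσ) (hpos := hpos)
    (altPay := altPay) (P := P) (X := X) hG T
  have ht := isDistStrategyTwo_gadgetCFR (S := S) (σ := σ) (hσ := hσ) (hpos := hpos)
    (altPay := altPay) (P := P) (X := X) hG T
  refine ⟨gadgetDistOne S σ hσ hpos altPay P X T, hd, ht, fun s₁ hs₁ => ?_, fun s₂ hs₂ => ?_⟩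
  · linarith [hC T hT0 s₁ hs₁ _ ht]
  · linarith [hC T hT0 _ hd s₂ hs₂]

/-- Along an ultrafilter the average strategies of player one, which depend on the observed
payoff through the functions `enterFrequency` only, have a limit that is at least as good: the
mean entering probabilities and the mean alternative payoffs converge, and a threshold rule
with the limiting mean entering probability is at least as good in terms of the latter. -/
theorem exists_limit_strategy (hG : G.PerfectRecall)
    (hX : ∀ h ∈ S.top, Integrable (X (G.info .one h)) P) (U : Ultrafilter ℕ)
    (hU : (U : Filter ℕ) ≤ atTop) :
    ∃ s₁, IsDistStrategy S σ hσ hpos s₁ ∧ ∀ s₂, ∃ l : ℝ,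
      Tendsto (fun T => distPayoff S σ hσ hpos P X (gadgetDistOne S σ hσ hpos altPay P X T) s₂) U
        (𝓝 l) ∧ l ≤ distPayoff S σ hσ hpos P X s₁ s₂ := by
  have hlim : ∀ (f : ℕ → ℝ) (a b : ℝ), (∀ n, f n ∈ Set.Icc a b) →
      ∃ r ∈ Set.Icc a b, Tendsto f U (𝓝 r) := fun f a b hf =>
    isCompact_Icc.ultrafilter_le_nhds' (U.map f)
      (Ultrafilter.mem_map.2 (Eventually.of_forall (f := (U : Filter ℕ)) hf))
  choose r hr01 hr using fun K a => hlim (fun T => gadgetCFROne S σ hσ hpos altPay P X T K a) 0 1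
    fun T => gadgetCFROne_mem_Icc T K a
  have hpos' : ∀ᶠ T in (U : Filter ℕ), 0 < T := hU (eventually_gt_atTop 0)
  have hp : ∀ J : Info .one, ∃ (p : ℝ → ℝ) (m : ℝ), Measurable p ∧
      (∀ x, p x ∈ Set.Icc (0 : ℝ) 1) ∧ (J ∈ S.top.image (G.info .one) →
        Tendsto (fun T => ∫ ω, enterFrequency S σ hσ hpos altPay P X T J (X J ω) * X J ω ∂P) U
          (𝓝 m) ∧ ∫ ω, p (X J ω) ∂P = r (.root J) .enter ∧ ∫ ω, p (X J ω) * X J ω ∂P ≤ m) := by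
    intro J
    by_cases hJ : J ∈ S.top.image (G.info .one)
    swap
    · exact ⟨fun _ => 0, 0, measurable_const, fun _ => by simp, fun h => absurd h hJ⟩
    obtain ⟨h, hh, rfl⟩ := Finset.mem_image.1 hJ
    have hXh := hX h hh
    have hfi := fun T => integrable_comp_mul_of_bound hXh
      (measurable_enterFrequency (S := S) (σ := σ) (hσ := hσ) (hpos := hpos) (altPay := altPay)
        (P := P) (X := X) T (G.info .one h)) fun x => abs_le_one_of_mem_Icc
        (enterFrequency_mem_Icc T (G.info .one h) x)
    have hf := fun T => integrable_comp_of_bound hXh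
      (measurable_enterFrequency (S := S) (σ := σ) (hσ := hσ) (hpos := hpos) (altPay := altPay)
        (P := P) (X := X) T (G.info .one h)) fun x => abs_le_one_of_mem_Icc
        (enterFrequency_mem_Icc T (G.info .one h) x)
    obtain ⟨m, -, hm⟩ := hlim (fun T => ∫ ω, enterFrequency S σ hσ hpos altPay P X T
      (G.info .one h) (X (G.info .one h) ω) * X (G.info .one h) ω ∂P)
      (-∫ ω, |X (G.info .one h) ω| ∂P) (∫ ω, |X (G.info .one h) ω| ∂P) fun T => by
        refine abs_le.1 (abs_integral_le_integral_abs.trans (integral_mono (hfi T).abs hXh.abs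
          fun ω => ?_))
        change |_ * _| ≤ _
        rw [abs_mul]
        exact mul_le_of_le_one_left (abs_nonneg _)
          (abs_le_one_of_mem_Icc (enterFrequency_mem_Icc _ _ _))
    -- Every rule `p` satisfies `p x * (x - θ) ≥ -(θ - x)⁺`; this bound survives the limit.
    have key : ∀ θ : ℝ, θ * r (.root (G.info .one h)) .enter -
        ∫ ω, max (θ - X (G.info .one h) ω) 0 ∂P ≤ m := by
      intro θ
      refine le_of_tendsto_of_tendsto
        (((hr (.root (G.info .one h)) .enter).const_mul θ).sub_const _) hm ?_
      filter_upwards [hpos'] with T hT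
      rw [← integral_enterFrequency hG hT hh hXh, ← integral_const_mul, ← integral_sub
        ((hf T).const_mul θ) (integrable_max_const_sub hXh θ)]
      refine integral_mono (((hf T).const_mul θ).sub (integrable_max_const_sub hXh θ)) (hfi T)
        fun ω => ?_
      have h01 := enterFrequency_mem_Icc (S := S) (σ := σ) (hσ := hσ) (hpos := hpos)
        (altPay := altPay) (P := P) (X := X) T (G.info .one h) (X (G.info .one h) ω)
      change θ * _ - max _ 0 ≤ _ * _
      have h2 := mul_le_mul_of_nonneg_left (le_max_left (θ - X (G.info .one h) ω) 0) h01.1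
      have h3 := mul_le_of_le_one_left (le_max_right (θ - X (G.info .one h) ω) 0) h01.2
      linarith
    obtain ⟨p, hpm, hp01, hpq, hple⟩ := exists_threshold_rule hXh
      (hr01 (.root (G.info .one h)) .enter) key
    exact ⟨p, m, hpm, hp01, fun _ => ⟨hm, hpq, hple⟩⟩
  choose p m hpm hp01 hpJ using hp
  refine ⟨rootMix p r, isDistStrategy_rootMix hpm hp01
    (isStrategy_of_tendsto (fun T => isStrategy_gadgetCFROne hG T) hr), fun s₂ => ?_⟩
  refine ⟨∑ h ∈ S.top, topProb S σ h * (r (.root (G.info .one h)) .enter *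
    enterValue S σ hσ hpos r s₂ h + (∫ ω, X (G.info .one h) ω ∂P - m (G.info .one h))), ?_, ?_⟩
  · refine Tendsto.congr' (f₁ := fun T => ∑ h ∈ S.top, topProb S σ h *
        (gadgetCFROne S σ hσ hpos altPay P X T (.root (G.info .one h)) .enter *
          enterValue S σ hσ hpos (gadgetCFROne S σ hσ hpos altPay P X T) s₂ h +
        (∫ ω, X (G.info .one h) ω ∂P - ∫ ω, enterFrequency S σ hσ hpos altPay P X T
          (G.info .one h) (X (G.info .one h) ω) * X (G.info .one h) ω ∂P))) ?_ ?_
    · filter_upwards [hpos'] with T hT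
      exact (distPayoff_gadgetDistOne hG hX hT s₂).symm
    · refine tendsto_finsetSum _ fun h hh => Tendsto.const_mul _ (((hr _ _).mul ?_).add
        ((hpJ _ (Finset.mem_image_of_mem _ hh)).1.const_sub _))
      refine tendsto_value (fun j K a => ?_) _ _
      cases j with
      | one => exact hr K a
      | two => exact tendsto_const_nhds
  · rw [distPayoff_rootMix hX hpm hp01]
    refine Finset.sum_le_sum fun h hh => mul_le_mul_of_nonneg_left ?_ (topProb_nonneg hσ hpos hh)
    obtain ⟨-, h2, h3⟩ := hpJ _ (Finset.mem_image_of_mem (G.info .one) hh)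
    rw [h2]
    linarith

theorem isDistNashStrategyTwo_of_mapClusterPt (hG : G.PerfectRecall)
    (hX : ∀ h ∈ S.top, Integrable (X (G.info .one h)) P)
    {s₂ : Strategy (AugAct A) (AugInfo (Info .two))}
    (hs₂ : MapClusterPt s₂ atTop (gadgetCFR S σ hσ hpos altPay P X)) :
    IsDistNashStrategyTwo S σ hσ hpos P X s₂ := by
  obtain ⟨C, hC⟩ := exists_gap_le (altPay := altPay) (hσ := hσ) (hpos := hpos) hG hX
  have h1 : Tendsto (fun T : ℕ => C / √(T : ℝ)) atTop (𝓝 0) :=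
    tendsto_const_nhds.div_atTop (Real.tendsto_sqrt_atTop.comp tendsto_natCast_atTop_atTop)
  obtain ⟨U, hU, hlim⟩ := mapClusterPt_iff_ultrafilter.1 hs₂
  have hlim' : ∀ K a, Tendsto (fun T => gadgetCFR S σ hσ hpos altPay P X T K a) U
      (𝓝 (s₂ K a)) := fun K a => tendsto_pi_nhds.1 (tendsto_pi_nhds.1 hlim K) a
  have hst : ∀ T, IsDistStrategyTwo S σ hσ hpos (gadgetCFR S σ hσ hpos altPay P X T) :=
    isDistStrategyTwo_gadgetCFR hG
  have hs : IsDistStrategyTwo S σ hσ hpos s₂ := isStrategy_of_tendsto hst hlim'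
  obtain ⟨s₁, hs₁, h₁⟩ := exists_limit_strategy (altPay := altPay) (hσ := hσ) (hpos := hpos)
    hG hX U hU
  have saddle : ∀ s₁', IsDistStrategy S σ hσ hpos s₁' → ∀ s₂', IsDistStrategyTwo S σ hσ hpos s₂' →
      distPayoff S σ hσ hpos P X s₁' s₂ ≤ distPayoff S σ hσ hpos P X s₁ s₂' := by
    intro s₁' hs₁' s₂' hs₂'
    obtain ⟨l, hl, hle⟩ := h₁ s₂'
    refine le_trans ?_ hle
    have h2 := hl.add (h1.mono_left hU)
    rw [add_zero] at h2
    refine le_of_tendsto_of_tendsto (tendsto_distPayoff hX hs₁' hst hlim') h2 ?_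
    filter_upwards [hU (eventually_gt_atTop 0)] with T hT
    exact hC T hT s₁' hs₁' s₂' hs₂'
  refine ⟨s₁, hs₁, hs, fun s₁' hs₁' => ?_, fun s₂' hs₂' => ?_⟩
  · linarith [saddle s₁' hs₁' s₂ hs]
  · linarith [saddle s₁ hs₁ s₂' hs₂']

end Gap

end Game

end

theorem theorem3 {A : Type u} {Info : Player → Type v} (G : Game A Info) (hG : G.PerfectRecall)
    (S : G.Subgame) (σ : Profile A Info) (hσ : ∀ i, G.IsStrategy i (σ i))
    (hpos : 0 < ∑ h ∈ S.top, G.reachOther σ .one h) (altPay : Info .one → ℝ)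
    {Ω : Type w} [MeasurableSpace Ω] (P : Measure Ω) [IsProbabilityMeasure P]
    (X : Info .one → Ω → ℝ) (hX : ∀ h ∈ S.top, Integrable (X (G.info .one h)) P) :
    (∀ ε : ℝ, 0 < ε → ∀ᶠ T in atTop,
      ∃ s₁, Game.IsDistEpsNash S σ (hσ .two) hpos P X ε s₁
        (Game.gadgetCFR S σ (hσ .two) hpos altPay P X T)) ∧
    (∀ s₂, MapClusterPt s₂ atTop (Game.gadgetCFR S σ (hσ .two) hpos altPay P X) →
      Game.IsDistNashStrategyTwo S σ (hσ .two) hpos P X s₂) :=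
  ⟨fun _ hε => Game.exists_isDistEpsNash hG hX hε,
    fun _ hs₂ => Game.isDistNashStrategyTwo_of_mapClusterPt hG hX hs₂⟩
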